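/- Let $H(y,x,\epsilon)$, $y=(y_1,y_2)$, be a germ of an analytic function at the origin of $\mathbb C^2\times\mathbb C\times\mathbb C$ such that $y\mapsto H(y,0,0)$ has a non-degenerate critical point at $y=0$, i.e. $D_yH(0,0,0)=0$ and $\det D_y^2H(0,0,0)\neq0$. It defines the family of systems $$x(x-\epsilon)\tfrac{dy_1}{dx}=\tfrac{\partial H}{\partial y_2},\qquad x(x-\epsilon)\tfrac{dy_2}{dx}=-\tfrac{\partial H}{\partial y_1},$$ with singular Hamiltonian $\frac{H}{x(x-\epsilon)}$, and the family of vector fields $Z_{H,\epsilon}=x(x-\epsilon)\partial_x+\frac{\partial H}{\partial y_2}\partial_{y_1}-\frac{\partial H}{\partial y_1}\partial_{y_2}$. A fibered transversely symplectic change of coordinates is an analytic germ $y=\Phi(u,x,\epsilon)$ at the origin with $\Phi(0,0,0)=0$ and $\det D_u\Phi\equiv1$. It transforms the system of $H$ to the system of $K$ if $\Phi^*Z_{H,\epsilon}=Z_{K,\epsilon}$, the pullback being by $(u,x)\mapsto(\Phi(u,x,\epsilon),x)$ for each $\epsilon$. A Birkhoff-Siegel normalization of $H$ is a pair $(\Phi,G)$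 of such a $\Phi$ and an analytic germ $G(h,x,\epsilon)$ at $0$ with $H(\Phi(u,x,\epsilon),x,\epsilon)=G(u_1u_2,x,\epsilon)$. A germ $\chi(h,x,\epsilon)$ is a formal invariant of $H$ if, for some Birkhoff-Siegel normalization $(\Phi,G)$, $$\chi(h,x,\epsilon)=\chi^{(0)}(h,\epsilon)+x\chi^{(1)}(h,\epsilon)=\tfrac{\partial G}{\partial h}(h,x,\epsilon)\mod x(x-\epsilon),$$ that is, $\chi^{(0)},\chi^{(1)}$ are analytic germs at $0$ and $\frac{\partial G}{\partial h}-\chi$ is $x(x-\epsilon)$ times an analytic germ. Then, as identities of germs: (1) $H$ has a formal invariant, and it is well defined up to the involution $J^*:\chi(h,x,\epsilon)\mapsto-\chi(-h,x,\epsilon)$: if $\chi$ is a formal invariant of $H$, then so is $J^*\chi$, and every formal invariant of $H$ equals $\chi$ or $J^*\chi$. The involution is induced by the symplectic transformation $J:(u_1,u_2)\mapsto(u_2,-u_1)$: if $(\Phi,G)$ is a Birkhoff-Siegel normalization of $H$ with formal invariant $\chi$, then $\big(\Phi(Ju,x,\epsilon),G(-h,x,\epsilon)\big)$ is one with formal invariant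 $J^*\chi$. (2) The formal invariant is determined by the polar part of $\frac{H}{x(x-\epsilon)}$: if $K$ is another germ as above and $H-K$ is $x(x-\epsilon)$ times an analytic germ, then $H$ and $K$ have the same formal invariants. (3) The formal invariant is invariant under fibered transversely symplectic changes of coordinates: if $K$ is another germ as above and such a change of coordinates transforms the system of $H$ to the system of $K$, then $H$ and $K$ have the same formal invariants. -/

import Mathlib

open Filter Topology

namespace ConfluentHamiltonian

/-- The fibre coordinate `y = (y₁, y₂)` (or `u = (u₁, u₂)`). -/
abbrev Plane : Type := ℂ × ℂ

/-- The total space of the points `(y, x, ε)`. Germs at the origin of this space are represented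
by everywhere defined functions, of which only the values near `0` matter. -/
abbrev PhaseSpace : Type := Plane × ℂ × ℂ

/-- The space of the points `(h, x, ε)`. -/
abbrev Base : Type := ℂ × ℂ × ℂ

/-- `∂F/∂y₁` at `(y, x, ε)`. -/
noncomputable def partialOne (F : PhaseSpace → ℂ) (p : PhaseSpace) : ℂ :=
  deriv (fun t : ℂ => F ((t, p.1.2), p.2)) p.1.1

/-- `∂F/∂y₂` at `(y, x, ε)`. -/
noncomputable def partialTwo (F : PhaseSpace → ℂ) (p : PhaseSpace) : ℂ :=
  deriv (fun t : ℂ => F ((p.1.1, t), p.2)) p.1.2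

/-- `∂G/∂h` at `(h, x, ε)`. -/
noncomputable def partialH (G : Base → ℂ) (q : Base) : ℂ :=
  deriv (fun t : ℂ => G (t, q.2)) q.1

/-- The Hessian matrix `D_y² F` at `(y, x, ε)`. -/
noncomputable def hessian (F : PhaseSpace → ℂ) (p : PhaseSpace) : Matrix (Fin 2) (Fin 2) ℂ :=
  !![partialOne (partialOne F) p, partialOne (partialTwo F) p;
     partialTwo (partialOne F) p, partialTwo (partialTwo F) p]

/-- `H` is an analytic germ at `(y, x, ε) = 0` such that `y ↦ H(y, 0, 0)` has a non-degenerate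
critical point at `y = 0`. These are the germs that define the systems
`x(x-ε) dy₁/dx = ∂H/∂y₂`, `x(x-ε) dy₂/dx = -∂H/∂y₁`. -/
structure IsHamiltonian (H : PhaseSpace → ℂ) : Prop where
  analytic : AnalyticAt ℂ H 0
  critical_one : partialOne H 0 = 0
  critical_two : partialTwo H 0 = 0
  nondegenerate : (hessian H 0).det ≠ 0

/-- The vector field `Z_{H,ε} = x(x-ε)∂_x + (∂H/∂y₂)∂_{y₁} - (∂H/∂y₁)∂_{y₂}` on the
`(y, x)`-space; its trajectories are the solutions of the system defined by `H`. -/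
noncomputable def vectorField (H : PhaseSpace → ℂ) (ε : ℂ) (p : Plane × ℂ) : Plane × ℂ :=
  ((partialTwo H (p.1, p.2, ε), -partialOne H (p.1, p.2, ε)), p.2 * (p.2 - ε))

/-- `y = Φ(u, x, ε)` is (the germ at the origin of) an analytic fibered change of coordinates
that is transversely symplectic: `det D_uΦ ≡ 1`. -/
structure IsTransverselySymplectic (Φ : PhaseSpace → Plane) : Prop where
  analytic : AnalyticAt ℂ Φ 0
  map_zero : Φ 0 = 0
  det_eq_one : ∀ᶠ p in 𝓝 (0 : PhaseSpace), (fderiv ℂ (fun u : Plane => Φ (u, p.2)) p.1).det = 1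

/-- The map `(u, x) ↦ (Φ(u, x, ε), x)` of the `(y, x)`-space, for a fixed `ε`. -/
def fiberedMap (Φ : PhaseSpace → Plane) (ε : ℂ) (p : Plane × ℂ) : Plane × ℂ :=
  (Φ (p.1, p.2, ε), p.2)

/-- The change of coordinates `y = Φ(u, x, ε)` transforms the system of `H` to the system of `K`,
that is `Φ^* Z_{H,ε} = Z_{K,ε}` as germs. -/
def Transforms (Φ : PhaseSpace → Plane) (H K : PhaseSpace → ℂ) : Prop :=
  ∀ᶠ p in 𝓝 (0 : PhaseSpace),
    VectorField.pullback ℂ (fiberedMap Φ p.2.2) (vectorField H p.2.2) (p.1, p.2.1) =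
      vectorField K p.2.2 (p.1, p.2.1)

/-- `(Φ, G)` is a Birkhoff-Siegel normalization of `H` depending analytically on `(x, ε)`:
`Φ` is transversely symplectic and `H(Φ(u, x, ε), x, ε) = G(u₁u₂, x, ε)`. -/
structure IsBirkhoffSiegel (H : PhaseSpace → ℂ) (Φ : PhaseSpace → Plane) (G : Base → ℂ) : Prop where
  symplectic : IsTransverselySymplectic Φ
  analytic : AnalyticAt ℂ G 0
  normal_form : ∀ᶠ p in 𝓝 (0 : PhaseSpace), H (Φ p, p.2) = G (p.1.1 * p.1.2, p.2)

/-- `χ = g mod x(x-ε)`: the germ `χ` is the remainder, of degree at most one in `x`, of the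
division of the germ `g` by `x(x-ε)`, that is `χ = χ₀(h, ε) + x χ₁(h, ε)` and
`g = χ + x(x-ε) Q` with analytic germs `χ₀`, `χ₁`, `Q`. -/
def IsRemainder (g χ : Base → ℂ) : Prop :=
  ∃ χ₀ χ₁ : ℂ × ℂ → ℂ, ∃ Q : Base → ℂ,
    AnalyticAt ℂ χ₀ 0 ∧ AnalyticAt ℂ χ₁ 0 ∧ AnalyticAt ℂ Q 0 ∧
    (∀ᶠ q in 𝓝 (0 : Base), χ q = χ₀ (q.1, q.2.2) + q.2.1 * χ₁ (q.1, q.2.2)) ∧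
    (∀ᶠ q in 𝓝 (0 : Base), g q = χ q + q.2.1 * (q.2.1 - q.2.2) * Q q)

/-- `χ` is a formal invariant of the system of `H`: `χ = ∂G/∂h mod x(x-ε)` for some
Birkhoff-Siegel normal form `G(u₁u₂, x, ε)` of `H`. -/
def IsFormalInvariant (H : PhaseSpace → ℂ) (χ : Base → ℂ) : Prop :=
  ∃ (Φ : PhaseSpace → Plane) (G : Base → ℂ), IsBirkhoffSiegel H Φ G ∧ IsRemainder (partialH G) χ

/-- `H/(x(x-ε))` and `K/(x(x-ε))` have the same polar part: they differ by an analytic germ. -/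
def SamePolarPart (H K : PhaseSpace → ℂ) : Prop :=
  ∃ R : PhaseSpace → ℂ, AnalyticAt ℂ R 0 ∧
    ∀ᶠ p in 𝓝 (0 : PhaseSpace), H p = K p + p.2.1 * (p.2.1 - p.2.2) * R p

/-- The symplectic transformation `J : (u₁, u₂) ↦ (u₂, -u₁)`, acting on the fibres. -/
def rotJ (p : PhaseSpace) : PhaseSpace := ((p.1.2, -p.1.1), p.2)

/-- The substitution `h ↦ -h`, `G(h, x, ε) ↦ G(-h, x, ε)`. -/
def mirror (G : Base → ℂ) (q : Base) : ℂ := G (-q.1, q.2)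

/-- The involution `J^* : χ(h, x, ε) ↦ -χ(-h, x, ε)`. -/
def reflection (χ : Base → ℂ) (q : Base) : ℂ := -χ (-q.1, q.2)

end ConfluentHamiltonian

open ConfluentHamiltonian

/-! Everything reduces to the values of ∂G/∂h over the polar locus x(x-ε) = 0. Division by x(x-ε) is
interpolation in x at the nodes 0 and ε, so the remainder depends only on the dividend over that
locus; the double node at ε = 0 is recovered by continuity. Adding to G a function of (x, ε), even a
non-analytic one, does not change ∂G/∂h. It therefore suffices to compare normalizations in the weak
sense of `NormalizesOn polarLocus`.

Uniqueness (`partialH_eq_of_conjugate`). Two normal forms are related by a symplectic ψ = (X, Y)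
with G₁(XY) = G₂(u₁u₂) + c. Taking the bracket with X gives E X = m X, where E = u₁∂₁ - u₂∂₂ and m
is the quotient of ∂G₁/∂h at XY by ∂G₂/∂h at u₁u₂. This m is constant along the 2π-periodic circles
of E, hence an integer wherever X ≠ 0. If m = 1 at the origin, then m = 1 nearby, and integration
gives XY = u₁u₂. Since the Hessian determinant of H is -(∂G/∂h(0))², only the sign of ∂G/∂h(0) is
ambiguous, and J exchanges the two signs.

Invariance. Germs with the same polar part agree over the polar locus. Under a change of
coordinates, the ∂_x component vanishes over the locus, so H∘Φ and K have the same fibrewise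
Hamiltonian fields and differ by a function of the parameters. Either way, a normal form of K also
normalizes H over the locus (`SamePolarPart.normalizesOn`, `Transforms.normalizesOn`).

Existence. After the critical point is moved to u = 0, the Morse lemma gives H∘φ = H(0) + u₁u₂, with
φ not yet symplectic. Averaging over the circle action splits the Jacobian J of φ as α(u₁u₂) + E b,
and from this one builds W of Jacobian J preserving the foliation by the levels of u₁u₂
(`exists_isochore`). Then φ∘W⁻¹ is symplectic and still makes H a function of u₁u₂. -/

section Tools

/-! ### Analytic germs: averages, division, inversion, square roots. -/

variable {E : Type*} [NormedAddCommGroup E] [NormedSpace ℂ E]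

/-- Weighted averages of an analytic germ over a continuous family of linear substitutions are
analytic. -/
theorem analyticAt_intervalIntegral_comp_clm {f : E → ℂ} (hf : AnalyticAt ℂ f 0)
    {T : ℝ → E →L[ℂ] E} (hT : Continuous T) {w : ℝ → ℂ} (hw : Continuous w) (a b : ℝ) :
    AnalyticAt ℂ (fun z => ∫ t in a..b, w t * f (T t z)) 0 := by
  obtain ⟨p, r, hp⟩ := hf
  obtain ⟨C₀, hC₀⟩ := (isCompact_uIcc (a := a) (b := b)).exists_bound_of_continuousOn
    hT.continuousOn
  obtain ⟨W, hW⟩ := (isCompact_uIcc (a := a) (b := b)).exists_bound_of_continuousOn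
    hw.continuousOn
  set C : ℝ := max C₀ 1 with hC
  have hC1 : 1 ≤ C := le_max_right _ _
  have hCpos : 0 < C := by linarith
  have hTC : ∀ t ∈ Set.uIcc a b, ‖T t‖ ≤ C := fun t ht => (hC₀ t ht).trans (le_max_left _ _)
  have hW0 : 0 ≤ W := (norm_nonneg _).trans (hW a Set.left_mem_uIcc)
  obtain ⟨ρ, hρ0, hρr⟩ := ENNReal.lt_iff_exists_nnreal_btwn.1 hp.r_pos
  have hρ0' : 0 < ρ := by exact_mod_cast hρ0
  have hρrad : (ρ : ENNReal) < p.radius := hρr.trans_le hp.r_le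
  have hsummable : Summable fun n => ‖p n‖ * (ρ : ℝ) ^ n := p.summable_norm_mul_pow hρrad
  -- Since `T t` is linear, the substitution respects homogeneous terms, and the power series can be
  -- averaged term by term.
  let q : FormalMultilinearSeries ℂ E ℂ := fun n =>
    ∫ t in a..b, w t • (p n).compContinuousLinearMap (fun _ => T t)
  have hcont : ∀ n, Continuous fun t => w t • (p n).compContinuousLinearMap (fun _ => T t) := by
    intro n
    refine hw.smul ?_
    have h := (ContinuousMultilinearMap.compContinuousLinearMapContinuousMultilinear ℂ
      (fun _ : Fin n => E) (fun _ : Fin n => E) ℂ).cont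
    have h2 : Continuous fun t : ℝ => (fun _ : Fin n => T t) := continuous_pi fun _ => hT
    exact ((ContinuousLinearMap.apply ℂ _ (p n)).continuous.comp (h.comp h2))
  have hbound : ∀ n, ∀ t ∈ Set.uIcc a b,
      ‖w t • (p n).compContinuousLinearMap (fun _ => T t)‖ ≤ W * (‖p n‖ * C ^ n) := by
    intro n t ht
    rw [norm_smul]
    refine mul_le_mul (hW t ht) ?_ (norm_nonneg _) hW0
    refine ((p n).norm_compContinuousLinearMap_le _).trans ?_
    refine mul_le_mul_of_nonneg_left ?_ (norm_nonneg _)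
    simp only [Finset.prod_const, Finset.card_univ, Fintype.card_fin]
    exact pow_le_pow_left₀ (norm_nonneg _) (hTC t ht) n
  have hqbound : ∀ n, ‖q n‖ ≤ W * (‖p n‖ * C ^ n) * |b - a| := fun n =>
    intervalIntegral.norm_integral_le_of_norm_le_const fun t ht =>
      hbound n t (Set.uIoc_subset_uIcc ht)
  -- The substitution enlarges the n-th term by at most C ^ n, which shrinking the radius from ρ to
  -- ρ / C absorbs.
  let σ : NNReal := ρ / ⟨C, hCpos.le⟩
  have hσ : (σ : ℝ) = ρ / C := rfl
  have hσ0 : 0 < σ := div_pos hρ0' (by exact_mod_cast hCpos)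
  obtain ⟨M, hM⟩ : ∃ M : ℝ, ∀ n, ‖p n‖ * (ρ : ℝ) ^ n ≤ M :=
    ⟨∑' n, ‖p n‖ * (ρ : ℝ) ^ n, fun n => hsummable.le_tsum n fun _ _ => by positivity⟩
  refine ⟨q, σ, ?_, by exact_mod_cast hσ0, ?_⟩
  · refine q.le_radius_of_bound (W * M * |b - a|) fun n => ?_
    calc ‖q n‖ * (σ : ℝ) ^ n ≤ (W * (‖p n‖ * C ^ n) * |b - a|) * (σ : ℝ) ^ n := by
          gcongr; exact hqbound n
      _ = W * (‖p n‖ * (ρ : ℝ) ^ n) * |b - a| := by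
          rw [hσ, div_pow]; field_simp
      _ ≤ W * M * |b - a| := by gcongr; exact hM n
  · intro y hy
    have hyσ : ‖y‖ < ρ / C := by
      have : y ∈ Metric.ball (0 : E) σ := by
        rw [← Metric.eball_coe]; exact hy
      rwa [mem_ball_zero_iff, hσ] at this
    have hCy : C * ‖y‖ < ρ := by rwa [lt_div_iff₀ hCpos, mul_comm] at hyσ
    have happ : ∀ n, q n (fun _ => y) = ∫ t in a..b, w t * p n (fun _ => T t y) := by
      intro n
      have := (ContinuousMultilinearMap.apply ℂ (fun _ : Fin n => E) ℂ
        (fun _ => y)).intervalIntegral_comp_comm ((hcont n).intervalIntegrable (μ := MeasureTheory.volume) a b)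
      rw [show q n (fun _ => y) = (ContinuousMultilinearMap.apply ℂ (fun _ : Fin n => E) ℂ
        (fun _ => y)) (q n) from rfl]
      rw [← this]
      rfl
    simp only [happ, zero_add]
    have hs : Summable fun n => W * (‖p n‖ * (ρ : ℝ) ^ n) := hsummable.mul_left W
    refine intervalIntegral.hasSum_integral_of_dominated_convergence
      (fun n _ => W * (‖p n‖ * (ρ : ℝ) ^ n)) ?_ ?_ ?_ ?_ ?_
    · intro n
      refine Continuous.aestronglyMeasurable ?_
      exact hw.mul ((p n).cont.comp (continuous_pi fun _ => hT.clm_apply continuous_const))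
    · intro n
      refine MeasureTheory.ae_of_all _ fun t ht => ?_
      have ht := Set.uIoc_subset_uIcc ht
      rw [norm_mul]
      refine mul_le_mul (hW t ht) ?_ (norm_nonneg _) hW0
      refine ((p n).le_opNorm _).trans ?_
      simp only [Finset.prod_const, Finset.card_univ, Fintype.card_fin]
      gcongr
      exact ((T t).le_opNorm y).trans ((mul_le_mul_of_nonneg_right (hTC t ht)
        (norm_nonneg _)).trans hCy.le)
    · exact MeasureTheory.ae_of_all _ fun t _ => hs
    · exact intervalIntegrable_const
    · refine MeasureTheory.ae_of_all _ fun t ht => ?_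
      have ht := Set.uIoc_subset_uIcc ht
      have : T t y ∈ Metric.eball (0 : E) r := by
        refine Metric.eball_subset_eball hρr.le ?_
        rw [Metric.eball_coe, mem_ball_zero_iff]
        exact ((T t).le_opNorm y).trans_lt ((mul_le_mul_of_nonneg_right (hTC t ht)
          (norm_nonneg _)).trans_lt hCy)
      have h := hp.hasSum this
      simp only [zero_add] at h
      exact h.mul_left (w t)

/-- Hadamard's lemma: the increment of an analytic germ along `v` from the hyperplane `ℓ = 0` is
divisible by the linear form `ℓ`. -/
theorem AnalyticAt.exists_sub_eq_mul [CompleteSpace E] {f : E → ℂ} (hf : AnalyticAt ℂ f 0)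
    (ℓ : E →L[ℂ] ℂ) (v : E) :
    ∃ Q : E → ℂ, AnalyticAt ℂ Q 0 ∧ ∀ᶠ z in 𝓝 (0 : E), f z - f (z - ℓ z • v) = ℓ z * Q z := by
  -- `T t z` runs along the segment from z - ℓ(z)v to z with velocity ℓ(z)v. The quotient is thus
  -- the integral of Df(T t z)v, and it is analytic because each `T t` is linear in z.
  let T : ℝ → E →L[ℂ] E := fun t => ContinuousLinearMap.id ℂ E - (1 - t : ℂ) • ℓ.smulRight v
  have hT : Continuous T := by fun_prop
  have hTapp : ∀ t z, T t z = z - (1 - t : ℂ) • ℓ z • v := fun t z => by simp [T]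
  have hf' : AnalyticAt ℂ (fun z => fderiv ℂ f z v) 0 :=
    ((ContinuousLinearMap.apply ℂ ℂ v).analyticAt _).comp hf.fderiv
  refine ⟨_, analyticAt_intervalIntegral_comp_clm hf' hT (w := fun _ => 1) continuous_const 0 1, ?_⟩
  obtain ⟨δ, hδ, hball⟩ := Metric.eventually_nhds_iff_ball.1 hf.eventually_analyticAt
  have hpre : ∀ᶠ z in 𝓝 (0 : E), ‖z‖ + ‖ℓ z • v‖ < δ := by
    have : Continuous fun z => ‖z‖ + ‖ℓ z • v‖ := by fun_prop
    exact this.continuousAt.eventually_lt continuousAt_const (by simpa using hδ)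
  filter_upwards [hpre] with z hz
  have hmem : ∀ t ∈ Set.Icc (0 : ℝ) 1, T t z ∈ Metric.ball (0 : E) δ := by
    intro t ht
    rw [mem_ball_zero_iff, hTapp]
    refine (norm_sub_le _ _).trans_lt (lt_of_le_of_lt ?_ hz)
    gcongr
    rw [norm_smul]
    refine mul_le_of_le_one_left (norm_nonneg _) ?_
    rw [show (1 - t : ℂ) = ((1 - t : ℝ) : ℂ) by push_cast; rfl, Complex.norm_real,
      Real.norm_eq_abs, abs_of_nonneg (by linarith [ht.2])]
    linarith [ht.1]
  have hder : ∀ t ∈ Set.uIcc (0 : ℝ) 1,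
      HasDerivAt (fun t : ℝ => f (T t z)) (ℓ z * fderiv ℂ f (T t z) v) t := by
    intro t ht
    rw [Set.uIcc_of_le zero_le_one] at ht
    have h1 : HasDerivAt (fun t : ℝ => T t z) (ℓ z • v) t := by
      simp only [hTapp]
      have h0 : HasDerivAt (fun t : ℝ => (1 - t : ℂ)) (-1) t := by
        simpa using (Complex.ofRealCLM.hasDerivAt (x := t)).const_sub 1
      simpa using (h0.smul_const (ℓ z • v)).const_sub z
    have h2 := (hball _ (hmem t ht)).differentiableAt.hasFDerivAt.restrictScalars ℝ
    have := h2.comp_hasDerivAt t h1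
    simpa [Function.comp_def] using this
  have hc : ContinuousOn (fun t : ℝ => ℓ z * fderiv ℂ f (T t z) v) (Set.uIcc 0 1) := by
    intro t ht
    rw [Set.uIcc_of_le zero_le_one] at ht
    have h1 : ContinuousAt (fun z => fderiv ℂ f z v) (T t z) :=
      (((ContinuousLinearMap.apply ℂ ℂ v).analyticAt _).comp
        (hball _ (hmem t ht)).fderiv).continuousAt
    have h2 : ContinuousAt (fun t : ℝ => T t z) t := (hT.clm_apply continuous_const).continuousAt
    exact (continuousAt_const.mul (ContinuousAt.comp (f := fun t : ℝ => T t z) h1 h2)).continuousWithinAt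
  have := intervalIntegral.integral_eq_sub_of_hasDerivAt hder hc.intervalIntegrable
  rw [intervalIntegral.integral_const_mul] at this
  simp only [one_mul]
  rw [this]
  simp [hTapp]

/-- The inverse function theorem for families of maps. -/
theorem AnalyticAt.exists_fibered_inverse {Y P : Type*} [NormedAddCommGroup Y] [NormedSpace ℂ Y]
    [FiniteDimensional ℂ Y] [NormedAddCommGroup P] [NormedSpace ℂ P] [FiniteDimensional ℂ P]
    {f : Y × P → Y} (hf : AnalyticAt ℂ f 0) (h0 : f 0 = 0)
    (hinj : ∀ v : Y, fderiv ℂ f 0 (v, 0) = 0 → v = 0) :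
    ∃ g : Y × P → Y, AnalyticAt ℂ g 0 ∧ g 0 = 0 ∧
      (∀ᶠ p in 𝓝 (0 : Y × P), f (g p, p.2) = p.1) ∧
      (∀ᶠ p in 𝓝 (0 : Y × P), g (f p, p.2) = p.1) := by
  have : CompleteSpace Y := FiniteDimensional.complete ℂ Y
  have : CompleteSpace P := FiniteDimensional.complete ℂ P
  -- Keeping the parameters as extra components makes the derivative block triangular, so
  -- injectivity of its fibre block suffices.
  let F : Y × P → Y × P := fun p => (f p, p.2)
  have hF : AnalyticAt ℂ F 0 := hf.prod analyticAt_snd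
  have hF0 : F 0 = 0 := by simp [F, h0]
  let D : Y × P →L[ℂ] Y × P := (fderiv ℂ f 0).prod (ContinuousLinearMap.snd ℂ Y P)
  have hD : HasFDerivAt F D 0 := hf.differentiableAt.hasFDerivAt.prodMk hasFDerivAt_snd
  have hDinj : Function.Injective (D : Y × P →ₗ[ℂ] Y × P) := by
    rw [← LinearMap.ker_eq_bot, LinearMap.ker_eq_bot']
    rintro ⟨v, q⟩ h
    have h1 : fderiv ℂ f 0 (v, q) = 0 := congrArg Prod.fst h
    have h2 : q = 0 := congrArg Prod.snd h
    subst h2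
    rw [hinj v h1]; rfl
  let e : (Y × P) ≃L[ℂ] (Y × P) :=
    (LinearEquiv.ofInjectiveEndo (D : Y × P →ₗ[ℂ] Y × P) hDinj).toContinuousLinearEquiv
  have he : (e : Y × P →L[ℂ] Y × P) = D := by ext <;> simp [e]
  have hFe : HasFDerivAt F (e : Y × P →L[ℂ] Y × P) 0 := by rw [he]; exact hD
  have hs : HasStrictFDerivAt F (e : Y × P →L[ℂ] Y × P) 0 :=
    hF.contDiffAt.hasStrictFDerivAt' (n := ⊤) hFe (by simp)
  let R := hs.localInverse F e 0
  have hR : AnalyticAt ℂ R 0 := by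
    have := (hF.contDiffAt (n := ⊤)).to_localInverse hFe (by simp)
    rw [hF0] at this
    exact this.analyticAt
  have hR0 : R 0 = 0 := by
    have := hs.localInverse_apply_image
    rwa [hF0] at this
  have hl : ∀ᶠ p in 𝓝 (0 : Y × P), R (F p) = p := hs.eventually_left_inverse
  have hr : ∀ᶠ p in 𝓝 (0 : Y × P), F (R p) = p := by
    have := hs.eventually_right_inverse
    rwa [hF0] at this
  refine ⟨fun p => (R p).1, analyticAt_fst.comp hR, by simp [hR0], ?_, ?_⟩
  · filter_upwards [hr] with p hp
    have h2 : (R p).2 = p.2 := (Prod.ext_iff.1 hp).2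
    have h1 : f (R p) = p.1 := (Prod.ext_iff.1 hp).1
    rw [← h2]; exact h1
  · filter_upwards [hl] with p hp
    exact (Prod.ext_iff.1 hp).1

/-- A nonvanishing analytic germ has an analytic square root with prescribed value. -/
theorem AnalyticAt.exists_sq_eq {f : E → ℂ} (hf : AnalyticAt ℂ f 0) {d : ℂ} (hd : d ^ 2 = f 0)
    (hd0 : d ≠ 0) :
    ∃ g : E → ℂ, AnalyticAt ℂ g 0 ∧ g 0 = d ∧ ∀ᶠ z in 𝓝 (0 : E), g z ^ 2 = f z := by
  have hf0 : f 0 ≠ 0 := by rw [← hd]; exact pow_ne_zero 2 hd0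
  have hq : AnalyticAt ℂ (fun z => f z / f 0) 0 := hf.div analyticAt_const hf0
  have h1 : f 0 / f 0 = 1 := div_self hf0
  have hlog : AnalyticAt ℂ (fun z => Complex.log (f z / f 0)) 0 :=
    hq.clog (by rw [h1]; exact Complex.one_mem_slitPlane)
  refine ⟨fun z => d * Complex.exp (Complex.log (f z / f 0) / 2),
    analyticAt_const.mul (hlog.div analyticAt_const two_ne_zero).cexp', by simp [h1], ?_⟩
  filter_upwards [hf.continuousAt.eventually_ne hf0] with z hz
  rw [mul_pow, ← Complex.exp_nat_mul, hd]
  push_cast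
  rw [mul_div_cancel₀ _ (two_ne_zero' ℂ), Complex.exp_log (div_ne_zero hz hf0)]
  field_simp

/-- An analytic germ that vanishes off a hyperplane vanishes. -/
theorem AnalyticAt.eventually_eq_zero_of_ne {f : E → ℂ} (hf : AnalyticAt ℂ f 0)
    {ℓ : E →L[ℂ] ℂ} {v : E} (hv : ℓ v = 1) (h : ∀ᶠ z in 𝓝 (0 : E), ℓ z ≠ 0 → f z = 0) :
    ∀ᶠ z in 𝓝 (0 : E), f z = 0 := by
  filter_upwards [eventually_eventually_nhds.2 h,
    hf.eventually_analyticAt.mono fun _ h => h.continuousAt] with z hz hc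
  by_contra hne
  -- By continuity f stays nonzero near z, which would force ℓ to vanish on a whole neighbourhood;
  -- this is impossible along v.
  have hℓ : ∀ᶠ y in 𝓝 z, ℓ y = 0 := by
    filter_upwards [hz, hc.eventually_ne hne] with y h₁ h₂
    by_contra h₃
    exact h₂ (h₁ h₃)
  have hz0 : ℓ z = 0 := hℓ.self_of_nhds
  have ht : Tendsto (fun t : ℂ => z + t • v) (𝓝 0) (𝓝 z) :=
    Continuous.tendsto' (by fun_prop) _ _ (by simp)
  have h₄ : ∀ᶠ t in 𝓝[≠] (0 : ℂ), t = 0 := by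
    refine Filter.Eventually.filter_mono nhdsWithin_le_nhds ?_
    filter_upwards [ht.eventually hℓ] with t h
    simpa [hz0, hv] using h
  obtain ⟨t, h₅, h₆⟩ := (h₄.and self_mem_nhdsWithin).exists
  exact h₆ h₅

end Tools

/-! ### Fibrewise derivatives and chain rules. -/

namespace ConfluentHamiltonian

/-- The derivative in the direction of `y₁`. -/
noncomputable def dOne (f : PhaseSpace → ℂ) (p : PhaseSpace) : ℂ := fderiv ℂ f p ((1, 0), 0)

/-- The derivative in the direction of `y₂`. -/
noncomputable def dTwo (f : PhaseSpace → ℂ) (p : PhaseSpace) : ℂ := fderiv ℂ f p ((0, 1), 0)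

/-- The derivative along the linear field `u₁ ∂₁ - u₂ ∂₂`. -/
noncomputable def euler (f : PhaseSpace → ℂ) (p : PhaseSpace) : ℂ :=
  p.1.1 * dOne f p - p.1.2 * dTwo f p

/-- The fibrewise Jacobian determinant. -/
noncomputable def jac (Φ : PhaseSpace → Plane) (p : PhaseSpace) : ℂ :=
  (fderiv ℂ (fun u : Plane => Φ (u, p.2)) p.1).det

theorem fderiv_fiber_apply (f : PhaseSpace → ℂ) (p : PhaseSpace) (v : Plane) :
    fderiv ℂ f p (v, 0) = v.1 * dOne f p + v.2 * dTwo f p := by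
  have : ((v, 0) : PhaseSpace) = v.1 • ((1, 0), 0) + v.2 • ((0, 1), 0) := by
    ext <;> simp
  rw [this, map_add, map_smul, map_smul]
  rfl

theorem _root_.AnalyticAt.dOne {f : PhaseSpace → ℂ} {p : PhaseSpace} (hf : AnalyticAt ℂ f p) :
    AnalyticAt ℂ (dOne f) p :=
  ((ContinuousLinearMap.apply ℂ ℂ (((1, 0), 0) : PhaseSpace)).analyticAt _).comp hf.fderiv

theorem _root_.AnalyticAt.dTwo {f : PhaseSpace → ℂ} {p : PhaseSpace} (hf : AnalyticAt ℂ f p) :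
    AnalyticAt ℂ (dTwo f) p :=
  ((ContinuousLinearMap.apply ℂ ℂ (((0, 1), 0) : PhaseSpace)).analyticAt _).comp hf.fderiv

theorem partialOne_eq_dOne {f : PhaseSpace → ℂ} {p : PhaseSpace} (hf : DifferentiableAt ℂ f p) :
    partialOne f p = dOne f p := by
  have h1 : HasDerivAt (fun t : ℂ => (((t, p.1.2), p.2) : PhaseSpace)) ((1, 0), 0) p.1.1 :=
    ((hasDerivAt_id _).prodMk (hasDerivAt_const _ _)).prodMk (hasDerivAt_const _ _)
  exact (HasFDerivAt.comp_hasDerivAt (f := fun t : ℂ => (((t, p.1.2), p.2) : PhaseSpace))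
    p.1.1 hf.hasFDerivAt h1).deriv

theorem partialTwo_eq_dTwo {f : PhaseSpace → ℂ} {p : PhaseSpace} (hf : DifferentiableAt ℂ f p) :
    partialTwo f p = dTwo f p := by
  have h1 : HasDerivAt (fun t : ℂ => (((p.1.1, t), p.2) : PhaseSpace)) ((0, 1), 0) p.1.2 :=
    ((hasDerivAt_const _ _).prodMk (hasDerivAt_id _)).prodMk (hasDerivAt_const _ _)
  exact (HasFDerivAt.comp_hasDerivAt (f := fun t : ℂ => (((p.1.1, t), p.2) : PhaseSpace))
    p.1.2 hf.hasFDerivAt h1).deriv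

theorem partialH_eq_fderiv {G : Base → ℂ} {q : Base} (hG : DifferentiableAt ℂ G q) :
    partialH G q = fderiv ℂ G q (1, 0) := by
  have h1 : HasDerivAt (fun t : ℂ => ((t, q.2) : Base)) (1, 0) q.1 :=
    (hasDerivAt_id _).prodMk (hasDerivAt_const _ _)
  exact (HasFDerivAt.comp_hasDerivAt (f := fun t : ℂ => ((t, q.2) : Base))
    q.1 hG.hasFDerivAt h1).deriv

theorem eventually_partialOne_eq {f : PhaseSpace → ℂ} {p : PhaseSpace} (hf : AnalyticAt ℂ f p) :
    partialOne f =ᶠ[𝓝 p] dOne f :=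
  hf.eventually_analyticAt.mono fun _ h => partialOne_eq_dOne h.differentiableAt

theorem eventually_partialTwo_eq {f : PhaseSpace → ℂ} {p : PhaseSpace} (hf : AnalyticAt ℂ f p) :
    partialTwo f =ᶠ[𝓝 p] dTwo f :=
  hf.eventually_analyticAt.mono fun _ h => partialTwo_eq_dTwo h.differentiableAt

theorem analyticAt_partialH {G : Base → ℂ} {q : Base} (hG : AnalyticAt ℂ G q) :
    AnalyticAt ℂ (partialH G) q := by
  have : AnalyticAt ℂ (fun q => fderiv ℂ G q (1, 0)) q :=
    ((ContinuousLinearMap.apply ℂ ℂ ((1, 0) : Base)).analyticAt _).comp hG.fderiv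
  refine this.congr (hG.eventually_analyticAt.mono fun _ h => ?_)
  exact (partialH_eq_fderiv h.differentiableAt).symm

theorem hessian_det_eq {f : PhaseSpace → ℂ} (hf : AnalyticAt ℂ f 0) :
    (hessian f 0).det =
      dOne (dOne f) 0 * dTwo (dTwo f) 0 - dOne (dTwo f) 0 * dTwo (dOne f) 0 := by
  have h1 := eventually_partialOne_eq hf
  have h2 := eventually_partialTwo_eq hf
  have a1 : AnalyticAt ℂ (partialOne f) 0 := hf.dOne.congr h1.symm
  have a2 : AnalyticAt ℂ (partialTwo f) 0 := hf.dTwo.congr h2.symm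
  simp only [hessian, Matrix.det_fin_two_of, partialOne_eq_dOne a1.differentiableAt,
    partialOne_eq_dOne a2.differentiableAt, partialTwo_eq_dTwo a1.differentiableAt,
    partialTwo_eq_dTwo a2.differentiableAt]
  simp only [dOne, dTwo] at *
  rw [h1.fderiv_eq, h2.fderiv_eq]

theorem fderiv_fiber {F : Type*} [NormedAddCommGroup F] [NormedSpace ℂ F] {f : PhaseSpace → F}
    {p : PhaseSpace} (hf : DifferentiableAt ℂ f p) :
    HasFDerivAt (fun u : Plane => f (u, p.2))
      ((fderiv ℂ f p).comp (ContinuousLinearMap.inl ℂ Plane (ℂ × ℂ))) p.1 := by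
  have h1 : HasFDerivAt (fun u : Plane => ((u, p.2) : PhaseSpace))
      (ContinuousLinearMap.inl ℂ Plane (ℂ × ℂ)) p.1 := by
    exact (hasFDerivAt_id _).prodMk (hasFDerivAt_const _ _)
  exact HasFDerivAt.comp (f := fun u : Plane => ((u, p.2) : PhaseSpace)) p.1 hf.hasFDerivAt h1

theorem dOne_dTwo_eq_of_fiber {f g : PhaseSpace → ℂ} {p : PhaseSpace}
    (hf : DifferentiableAt ℂ f p) (hg : DifferentiableAt ℂ g p) {c : ℂ}
    (h : ∀ᶠ u in 𝓝 p.1, f (u, p.2) = g (u, p.2) + c) : dOne f p = dOne g p ∧ dTwo f p = dTwo g p := by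
  have h1 := fderiv_fiber hf
  have h2 := (fderiv_fiber hg).add_const c
  have h3 := h1.unique (h2.congr_of_eventuallyEq h)
  exact ⟨by simpa [dOne] using congrArg (fun A => A (1, 0)) h3,
    by simpa [dTwo] using congrArg (fun A => A (0, 1)) h3⟩

/-- The condition on S concerns only the parameters, so it persists along a whole fibre, where c is
constant. No regularity of S or c enters. -/
theorem eventually_dOne_dTwo_eq {f g : PhaseSpace → ℂ} {S : Set (ℂ × ℂ)} {c : ℂ × ℂ → ℂ}
    (hf : AnalyticAt ℂ f 0) (hg : AnalyticAt ℂ g 0)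
    (h : ∀ᶠ p in 𝓝 (0 : PhaseSpace), p.2 ∈ S → f p = g p + c p.2) :
    ∀ᶠ p in 𝓝 (0 : PhaseSpace), p.2 ∈ S → dOne f p = dOne g p ∧ dTwo f p = dTwo g p := by
  filter_upwards [hf.eventually_analyticAt, hg.eventually_analyticAt,
    eventually_eventually_nhds.2 h] with p h1 h2 h3 hp
  refine dOne_dTwo_eq_of_fiber h1.differentiableAt h2.differentiableAt (c := c p.2) ?_
  have : ContinuousAt (fun u : Plane => ((u, p.2) : PhaseSpace)) p.1 := by fun_prop
  filter_upwards [this.eventually h3] with u hu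
  exact hu hp

/-- Functions with the same fibrewise derivatives differ by a constant on each fibre of a ball. -/
theorem sub_eq_sub_of_dOne_dTwo_eq {f g : PhaseSpace → ℂ} {δ : ℝ}
    (hf : ∀ p : PhaseSpace, ‖p‖ < δ → DifferentiableAt ℂ f p)
    (hg : ∀ p : PhaseSpace, ‖p‖ < δ → DifferentiableAt ℂ g p) {p : PhaseSpace} (hp : ‖p‖ < δ)
    (h : ∀ u : Plane, ‖((u, p.2) : PhaseSpace)‖ < δ →
      dOne f (u, p.2) = dOne g (u, p.2) ∧ dTwo f (u, p.2) = dTwo g (u, p.2)) :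
    f p - g p = f (0, p.2) - g (0, p.2) := by
  have hder : ∀ u ∈ Metric.ball (0 : Plane) δ,
      HasFDerivAt (fun u : Plane => f (u, p.2) - g (u, p.2)) (0 : Plane →L[ℂ] ℂ) u := by
    intro u hu
    rw [mem_ball_zero_iff] at hu
    have hu' : ‖((u, p.2) : PhaseSpace)‖ < δ := max_lt hu ((norm_snd_le p).trans_lt hp)
    obtain ⟨e1, e2⟩ := h u hu'
    refine ((fderiv_fiber (p := (u, p.2)) (hf _ hu')).sub
      (fderiv_fiber (p := (u, p.2)) (hg _ hu'))).congr_fderiv ?_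
    ext
    · simpa [sub_eq_zero, dOne] using e1
    · simpa [sub_eq_zero, dTwo] using e2
  exact Metric.isOpen_ball.is_const_of_fderiv_eq_zero (𝕜 := ℂ)
    (convex_ball (0 : Plane) δ).isPreconnected
    (fun u hu => (hder u hu).differentiableAt.differentiableWithinAt)
    (fun u hu => (hder u hu).fderiv) (x := p.1) (y := 0)
    (mem_ball_zero_iff.2 ((norm_fst_le p).trans_lt hp))
    (Metric.mem_ball_self ((norm_nonneg p).trans_lt hp))

theorem det_plane (A : Plane →L[ℂ] Plane) :
    A.det = (A (1, 0)).1 * (A (0, 1)).2 - (A (0, 1)).1 * (A (1, 0)).2 := by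
  rw [ContinuousLinearMap.det, ← LinearMap.det_toMatrix (Module.Basis.finTwoProd ℂ),
    Matrix.det_fin_two]
  simp [LinearMap.toMatrix_apply]

theorem jac_eq {Φ : PhaseSpace → Plane} {p : PhaseSpace} (hΦ : DifferentiableAt ℂ Φ p) :
    jac Φ p = dOne (fun p => (Φ p).1) p * dTwo (fun p => (Φ p).2) p
      - dTwo (fun p => (Φ p).1) p * dOne (fun p => (Φ p).2) p := by
  have h1 : fderiv ℂ (fun p => (Φ p).1) p =
    (ContinuousLinearMap.fst ℂ ℂ ℂ).comp (fderiv ℂ Φ p) := hΦ.hasFDerivAt.fst.fderiv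
  have h2 : fderiv ℂ (fun p => (Φ p).2) p =
    (ContinuousLinearMap.snd ℂ ℂ ℂ).comp (fderiv ℂ Φ p) := hΦ.hasFDerivAt.snd.fderiv
  rw [jac, (fderiv_fiber hΦ).fderiv, det_plane]
  simp [dOne, dTwo, h1, h2]

theorem dOne_dTwo_comp {f : PhaseSpace → ℂ} {Φ : PhaseSpace → Plane} {p : PhaseSpace}
    (hf : DifferentiableAt ℂ f (Φ p, p.2)) (hΦ : DifferentiableAt ℂ Φ p) :
    dOne (fun p => f (Φ p, p.2)) p = dOne f (Φ p, p.2) * dOne (fun p => (Φ p).1) p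
        + dTwo f (Φ p, p.2) * dOne (fun p => (Φ p).2) p ∧
    dTwo (fun p => f (Φ p, p.2)) p = dOne f (Φ p, p.2) * dTwo (fun p => (Φ p).1) p
        + dTwo f (Φ p, p.2) * dTwo (fun p => (Φ p).2) p := by
  have h1 : fderiv ℂ (fun p => (Φ p).1) p =
    (ContinuousLinearMap.fst ℂ ℂ ℂ).comp (fderiv ℂ Φ p) := hΦ.hasFDerivAt.fst.fderiv
  have h2 : fderiv ℂ (fun p => (Φ p).2) p =
    (ContinuousLinearMap.snd ℂ ℂ ℂ).comp (fderiv ℂ Φ p) := hΦ.hasFDerivAt.snd.fderiv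
  have h3 : HasFDerivAt (fun p : PhaseSpace => (Φ p, p.2))
      ((fderiv ℂ Φ p).prod (ContinuousLinearMap.snd ℂ Plane (ℂ × ℂ))) p :=
    hΦ.hasFDerivAt.prodMk hasFDerivAt_snd
  have h4 : fderiv ℂ (fun p => f (Φ p, p.2)) p = _ :=
    (HasFDerivAt.comp (f := fun p : PhaseSpace => (Φ p, p.2)) p hf.hasFDerivAt h3).fderiv
  constructor
  · rw [dOne, h4]
    refine (fderiv_fiber_apply f _ (fderiv ℂ Φ p ((1, 0), 0))).trans ?_
    simp only [dOne, dTwo, h1, h2, ContinuousLinearMap.comp_apply, ContinuousLinearMap.coe_fst',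
      ContinuousLinearMap.coe_snd']
    ring
  · rw [dTwo, h4]
    refine (fderiv_fiber_apply f _ (fderiv ℂ Φ p ((0, 1), 0))).trans ?_
    simp only [dOne, dTwo, h1, h2, ContinuousLinearMap.comp_apply, ContinuousLinearMap.coe_fst',
      ContinuousLinearMap.coe_snd']
    ring

theorem dOne_dTwo_base {G : Base → ℂ} {f : PhaseSpace → ℂ} {p : PhaseSpace}
    (hG : DifferentiableAt ℂ G (f p, p.2)) (hf : DifferentiableAt ℂ f p) :
    dOne (fun p => G (f p, p.2)) p = partialH G (f p, p.2) * dOne f p ∧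
    dTwo (fun p => G (f p, p.2)) p = partialH G (f p, p.2) * dTwo f p := by
  have h3 : HasFDerivAt (fun p : PhaseSpace => (f p, p.2))
      ((fderiv ℂ f p).prod (ContinuousLinearMap.snd ℂ Plane (ℂ × ℂ))) p :=
    hf.hasFDerivAt.prodMk hasFDerivAt_snd
  have h4 : fderiv ℂ (fun p => G (f p, p.2)) p = _ :=
    (HasFDerivAt.comp (f := fun p : PhaseSpace => (f p, p.2)) p hG.hasFDerivAt h3).fderiv
  have h5 : ∀ a : ℂ, fderiv ℂ G (f p, p.2) (a, 0) = partialH G (f p, p.2) * a := by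
    intro a
    rw [partialH_eq_fderiv hG, mul_comm, ← smul_eq_mul, ← map_smul]
    simp
  constructor
  · rw [dOne, h4]; simp [h5, dOne]
  · rw [dTwo, h4]; simp [h5, dTwo]

theorem dOne_dTwo_mul {f g : PhaseSpace → ℂ} {p : PhaseSpace}
    (hf : DifferentiableAt ℂ f p) (hg : DifferentiableAt ℂ g p) :
    dOne (fun p => f p * g p) p = f p * dOne g p + g p * dOne f p ∧
    dTwo (fun p => f p * g p) p = f p * dTwo g p + g p * dTwo f p := by
  have h : fderiv ℂ (fun p => f p * g p) p = _ := (hf.hasFDerivAt.mul hg.hasFDerivAt).fderiv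
  constructor
  · rw [dOne, h]; rfl
  · rw [dTwo, h]; rfl

theorem dOne_dTwo_add {f g : PhaseSpace → ℂ} {p : PhaseSpace}
    (hf : DifferentiableAt ℂ f p) (hg : DifferentiableAt ℂ g p) :
    dOne (fun p => f p + g p) p = dOne f p + dOne g p ∧
    dTwo (fun p => f p + g p) p = dTwo f p + dTwo g p := by
  have h : fderiv ℂ (fun p => f p + g p) p = _ := (hf.hasFDerivAt.add hg.hasFDerivAt).fderiv
  constructor
  · rw [dOne, h]; rfl
  · rw [dTwo, h]; rfl

theorem hasFDerivAt_coord_one (p : PhaseSpace) : HasFDerivAt (fun p : PhaseSpace => p.1.1)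
    ((ContinuousLinearMap.fst ℂ ℂ ℂ).comp (ContinuousLinearMap.fst ℂ Plane (ℂ × ℂ))) p :=
  ((ContinuousLinearMap.fst ℂ ℂ ℂ).comp (ContinuousLinearMap.fst ℂ Plane (ℂ × ℂ))).hasFDerivAt

theorem hasFDerivAt_coord_two (p : PhaseSpace) : HasFDerivAt (fun p : PhaseSpace => p.1.2)
    ((ContinuousLinearMap.snd ℂ ℂ ℂ).comp (ContinuousLinearMap.fst ℂ Plane (ℂ × ℂ))) p :=
  ((ContinuousLinearMap.snd ℂ ℂ ℂ).comp (ContinuousLinearMap.fst ℂ Plane (ℂ × ℂ))).hasFDerivAt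

@[simp] theorem dOne_coord_one (p : PhaseSpace) : dOne (fun p => p.1.1) p = 1 := by
  rw [dOne, (hasFDerivAt_coord_one p).fderiv]; simp

@[simp] theorem dTwo_coord_one (p : PhaseSpace) : dTwo (fun p => p.1.1) p = 0 := by
  rw [dTwo, (hasFDerivAt_coord_one p).fderiv]; simp

@[simp] theorem dOne_coord_two (p : PhaseSpace) : dOne (fun p => p.1.2) p = 0 := by
  rw [dOne, (hasFDerivAt_coord_two p).fderiv]; simp

@[simp] theorem dTwo_coord_two (p : PhaseSpace) : dTwo (fun p => p.1.2) p = 1 := by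
  rw [dTwo, (hasFDerivAt_coord_two p).fderiv]; simp

/-- The product `h = u₁ u₂`. -/
def prodUV (p : PhaseSpace) : ℂ := p.1.1 * p.1.2

theorem analyticAt_coord_one (p : PhaseSpace) : AnalyticAt ℂ (fun p : PhaseSpace => p.1.1) p :=
  analyticAt_fst.comp analyticAt_fst

theorem analyticAt_coord_two (p : PhaseSpace) : AnalyticAt ℂ (fun p : PhaseSpace => p.1.2) p :=
  analyticAt_snd.comp analyticAt_fst

theorem analyticAt_prodUV (p : PhaseSpace) : AnalyticAt ℂ prodUV p :=
  (analyticAt_coord_one p).mul (analyticAt_coord_two p)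

@[simp] theorem dOne_prodUV (p : PhaseSpace) : dOne prodUV p = p.1.2 := by
  have := (dOne_dTwo_mul (analyticAt_coord_one p).differentiableAt
    (analyticAt_coord_two p).differentiableAt).1
  simp only [dOne_coord_one, dOne_coord_two, mul_zero, zero_add, mul_one] at this
  exact this

@[simp] theorem dTwo_prodUV (p : PhaseSpace) : dTwo prodUV p = p.1.1 := by
  have := (dOne_dTwo_mul (analyticAt_coord_one p).differentiableAt
    (analyticAt_coord_two p).differentiableAt).2
  simp only [dTwo_coord_one, dTwo_coord_two, mul_zero, add_zero, mul_one] at this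
  exact this

/-! ### Fibrewise Jacobians and transversely symplectic germs. -/

theorem jac_comp {Φ Ψ : PhaseSpace → Plane} {p : PhaseSpace}
    (hΦ : DifferentiableAt ℂ Φ (Ψ p, p.2)) (hΨ : DifferentiableAt ℂ Ψ p) :
    jac (fun p => Φ (Ψ p, p.2)) p = jac Φ (Ψ p, p.2) * jac Ψ p := by
  have h1 := (fderiv_fiber hΦ).differentiableAt
  have h2 := (fderiv_fiber hΨ).differentiableAt
  rw [jac, fderiv_fun_comp (f := fun u : Plane => Ψ (u, p.2)) (g := fun v : Plane => Φ (v, p.2)) p.1 h1 h2,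
    ContinuousLinearMap.det, ContinuousLinearMap.toLinearMap_comp, LinearMap.det_comp]
  rfl

theorem analyticAt_fibered {F : Type*} [NormedAddCommGroup F] [NormedSpace ℂ F]
    {Φ : PhaseSpace → F} (hΦ : AnalyticAt ℂ Φ 0) :
    AnalyticAt ℂ (fun p : PhaseSpace => (Φ p, p.2)) 0 := hΦ.prod analyticAt_snd

theorem fibered_zero {Y : Type*} [Zero Y] {f : PhaseSpace → Y} (h0 : f 0 = 0) :
    ((f 0, (0 : PhaseSpace).2) : Y × ℂ × ℂ) = 0 := by rw [h0]; rfl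

theorem tendsto_fibered {F : Type*} [NormedAddCommGroup F] [NormedSpace ℂ F] {f : PhaseSpace → F}
    (ha : AnalyticAt ℂ f 0) (h0 : f 0 = 0) :
    Tendsto (fun p : PhaseSpace => (f p, p.2)) (𝓝 0) (𝓝 0) := by
  have := (analyticAt_fibered ha).continuousAt.tendsto
  rwa [fibered_zero h0] at this

theorem analyticAt_fibered_comp {F F' : Type*} [NormedAddCommGroup F] [NormedSpace ℂ F]
    [NormedAddCommGroup F'] [NormedSpace ℂ F'] {f : PhaseSpace → F} (hf : AnalyticAt ℂ f 0)
    (h0 : f 0 = 0) {g : F × ℂ × ℂ → F'} (hg : AnalyticAt ℂ g 0) :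
    AnalyticAt ℂ (fun p : PhaseSpace => g (f p, p.2)) 0 :=
  AnalyticAt.fun_comp (f := fun p : PhaseSpace => (f p, p.2)) (by rwa [fibered_zero h0])
    (analyticAt_fibered hf)

theorem IsTransverselySymplectic.eventually_jac {Φ : PhaseSpace → Plane}
    (h : IsTransverselySymplectic Φ) : ∀ᶠ p in 𝓝 (0 : PhaseSpace), jac Φ p = 1 := h.det_eq_one

theorem IsTransverselySymplectic.tendsto {Φ : PhaseSpace → Plane}
    (h : IsTransverselySymplectic Φ) :
    Tendsto (fun p : PhaseSpace => ((Φ p, p.2) : PhaseSpace)) (𝓝 0) (𝓝 0) :=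
  tendsto_fibered h.analytic h.map_zero

theorem IsTransverselySymplectic.analyticAt_comp {F : Type*} [NormedAddCommGroup F]
    [NormedSpace ℂ F] {Φ : PhaseSpace → Plane} (h : IsTransverselySymplectic Φ)
    {f : PhaseSpace → F} (hf : AnalyticAt ℂ f 0) :
    AnalyticAt ℂ (fun p : PhaseSpace => f (Φ p, p.2)) 0 :=
  analyticAt_fibered_comp h.analytic h.map_zero hf

theorem IsTransverselySymplectic.comp {Φ Ψ : PhaseSpace → Plane}
    (hΦ : IsTransverselySymplectic Φ) (hΨ : IsTransverselySymplectic Ψ) :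
    IsTransverselySymplectic (fun p => Φ (Ψ p, p.2)) where
  analytic := hΨ.analyticAt_comp hΦ.analytic
  map_zero := by rw [fibered_zero hΨ.map_zero, hΦ.map_zero]
  det_eq_one := by
    filter_upwards [hΨ.tendsto.eventually hΦ.analytic.eventually_analyticAt,
      hΨ.analytic.eventually_analyticAt, hΨ.tendsto.eventually hΦ.eventually_jac,
      hΨ.eventually_jac] with p h1 h2 h3 h4
    have := jac_comp h1.differentiableAt h2.differentiableAt
    rw [h3, h4, mul_one] at this
    exact this

theorem exists_fibered_inverse_of_jac {Φ : PhaseSpace → Plane} (ha : AnalyticAt ℂ Φ 0)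
    (h0 : Φ 0 = 0) (hj : jac Φ 0 ≠ 0) :
    ∃ Ψ : PhaseSpace → Plane, AnalyticAt ℂ Ψ 0 ∧ Ψ 0 = 0 ∧
      (∀ᶠ p in 𝓝 (0 : PhaseSpace), Φ (Ψ p, p.2) = p.1) ∧
      (∀ᶠ p in 𝓝 (0 : PhaseSpace), Ψ (Φ p, p.2) = p.1) := by
  refine ha.exists_fibered_inverse h0 fun v hv => ?_
  rw [jac, (fderiv_fiber ha.differentiableAt).fderiv, ContinuousLinearMap.det] at hj
  have := LinearMap.ker_eq_bot'.1 (LinearMap.ker_eq_bot.2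
    (LinearEquiv.ofIsUnitDet (v := Module.Basis.finTwoProd ℂ) (v' := Module.Basis.finTwoProd ℂ) (f := ((fderiv ℂ Φ 0).comp
      (ContinuousLinearMap.inl ℂ Plane (ℂ × ℂ)) : Plane →ₗ[ℂ] Plane))
      (by rw [LinearMap.det_toMatrix]; exact isUnit_iff_ne_zero.2 hj)).injective) v
  exact this hv

theorem jac_mul_jac_of_inverse {Φ Ψ : PhaseSpace → Plane} (hΦ : AnalyticAt ℂ Φ 0)
    (hΨ : AnalyticAt ℂ Ψ 0) (h0 : Ψ 0 = 0)
    (h : ∀ᶠ p in 𝓝 (0 : PhaseSpace), Φ (Ψ p, p.2) = p.1) :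
    ∀ᶠ p in 𝓝 (0 : PhaseSpace), jac Φ (Ψ p, p.2) * jac Ψ p = 1 := by
  filter_upwards [(tendsto_fibered hΨ h0).eventually hΦ.eventually_analyticAt,
    hΨ.eventually_analyticAt, eventually_eventually_nhds.2 h] with p h1 h2 h4
  rw [← jac_comp h1.differentiableAt h2.differentiableAt]
  have hc : ContinuousAt (fun u : Plane => ((u, p.2) : PhaseSpace)) p.1 := by fun_prop
  have h6 : (fun u : Plane => Φ (Ψ (u, p.2), p.2)) =ᶠ[𝓝 p.1] id := hc.eventually h4
  rw [jac, h6.fderiv_eq, fderiv_id, ContinuousLinearMap.det]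
  simp

theorem IsTransverselySymplectic.exists_inverse {Φ : PhaseSpace → Plane}
    (hΦ : IsTransverselySymplectic Φ) :
    ∃ Ψ : PhaseSpace → Plane, IsTransverselySymplectic Ψ ∧
      (∀ᶠ p in 𝓝 (0 : PhaseSpace), Φ (Ψ p, p.2) = p.1) := by
  obtain ⟨Ψ, ha, h0, hr, -⟩ := exists_fibered_inverse_of_jac hΦ.analytic hΦ.map_zero
    (by rw [hΦ.eventually_jac.self_of_nhds]; exact one_ne_zero)
  refine ⟨Ψ, ⟨ha, h0, ?_⟩, hr⟩
  filter_upwards [(tendsto_fibered ha h0).eventually hΦ.eventually_jac,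
    jac_mul_jac_of_inverse hΦ.analytic ha h0 hr] with p h1 h2
  rw [h1, one_mul] at h2
  exact h2

theorem isTransverselySymplectic_swap :
    IsTransverselySymplectic (fun p : PhaseSpace => (p.1.2, -p.1.1)) where
  analytic := (analyticAt_coord_two _).prod (analyticAt_coord_one _).neg
  map_zero := by simp
  det_eq_one := by
    refine Eventually.of_forall fun p => ?_
    have h : HasFDerivAt (fun u : Plane => ((u.2, -u.1) : Plane))
      ((ContinuousLinearMap.snd ℂ ℂ ℂ).prod (-ContinuousLinearMap.fst ℂ ℂ ℂ)) p.1 :=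
      hasFDerivAt_snd.prodMk hasFDerivAt_fst.neg
    rw [h.fderiv, det_plane]
    simp

theorem IsTransverselySymplectic.comp_rotJ {Φ : PhaseSpace → Plane}
    (hΦ : IsTransverselySymplectic Φ) : IsTransverselySymplectic (Φ ∘ rotJ) :=
  hΦ.comp isTransverselySymplectic_swap

/-! ### The linear flow and its circle action. -/

/-- The flow of the linear field `u₁ ∂₁ - u₂ ∂₂`. -/
noncomputable def flow (s : ℂ) : PhaseSpace →L[ℂ] PhaseSpace :=
  ((Complex.exp s • (ContinuousLinearMap.fst ℂ ℂ ℂ).comp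
      (ContinuousLinearMap.fst ℂ Plane (ℂ × ℂ))).prod
    (Complex.exp (-s) • (ContinuousLinearMap.snd ℂ ℂ ℂ).comp
      (ContinuousLinearMap.fst ℂ Plane (ℂ × ℂ)))).prod (ContinuousLinearMap.snd ℂ Plane (ℂ × ℂ))

theorem flow_apply (s : ℂ) (p : PhaseSpace) :
    flow s p = ((Complex.exp s * p.1.1, Complex.exp (-s) * p.1.2), p.2) := rfl

@[simp] theorem flow_snd (s : ℂ) (p : PhaseSpace) : (flow s p).2 = p.2 := rfl

@[simp] theorem prodUV_flow (s : ℂ) (p : PhaseSpace) : prodUV (flow s p) = prodUV p := by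
  have : Complex.exp s * Complex.exp (-s) = 1 := by rw [← Complex.exp_add]; simp
  simp only [prodUV, flow_apply]
  linear_combination p.1.1 * p.1.2 * this

@[simp] theorem flow_zero (p : PhaseSpace) : flow 0 p = p := by simp [flow_apply]

theorem flow_add (s t : ℂ) (p : PhaseSpace) : flow (s + t) p = flow s (flow t p) := by
  simp only [flow_apply, neg_add, Complex.exp_add]
  ext <;> simp <;> ring

theorem flow_two_pi (p : PhaseSpace) : flow (2 * Real.pi * Complex.I) p = p := by
  simp [flow_apply, Complex.exp_neg, Complex.exp_two_pi_mul_I]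

/-- In imaginary time the coordinates are only rotated. Balls are therefore unions of full orbits,
and local identities can be followed around a whole circle. -/
theorem norm_flow (θ : ℝ) (p : PhaseSpace) : ‖flow (θ * Complex.I) p‖ = ‖p‖ := by
  have h : ‖Complex.exp (-(θ * Complex.I))‖ = 1 := by
    rw [← neg_mul, ← Complex.ofReal_neg, Complex.norm_exp_ofReal_mul_I]
  simp [flow_apply, Prod.norm_def, Complex.norm_exp_ofReal_mul_I, h]

theorem hasDerivAt_flow {f : PhaseSpace → ℂ} {s : ℂ} {p : PhaseSpace}
    (hf : DifferentiableAt ℂ f (flow s p)) :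
    HasDerivAt (fun s => f (flow s p)) (euler f (flow s p)) s := by
  have h1 : HasDerivAt (fun s => flow s p)
      ((Complex.exp s * p.1.1, -Complex.exp (-s) * p.1.2), 0) s := by
    refine HasDerivAt.prodMk (HasDerivAt.prodMk ?_ ?_) (hasDerivAt_const _ _)
    · exact (Complex.hasDerivAt_exp s).mul_const _
    · have := ((hasDerivAt_neg s).cexp).mul_const p.1.2
      simpa using this
  have h2 := HasFDerivAt.comp_hasDerivAt (f := fun s => flow s p) s hf.hasFDerivAt h1
  refine h2.congr_deriv ?_
  refine (fderiv_fiber_apply _ _ _).trans ?_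
  simp only [euler, flow_apply]
  ring

theorem hasDerivAt_flow_mul_I {f : PhaseSpace → ℂ} {θ : ℝ} {p : PhaseSpace}
    (hf : DifferentiableAt ℂ f (flow (θ * Complex.I) p)) :
    HasDerivAt (fun θ : ℝ => f (flow (θ * Complex.I) p))
      (Complex.I * euler f (flow (θ * Complex.I) p)) θ := by
  have h1 : HasDerivAt (fun θ : ℝ => (θ * Complex.I : ℂ)) Complex.I θ := by
    simpa using (Complex.ofRealCLM.hasDerivAt (x := θ)).mul_const Complex.I
  have := HasDerivAt.comp (h := fun θ : ℝ => (θ * Complex.I : ℂ)) θ (hasDerivAt_flow hf) h1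
  rw [mul_comm] at this
  exact this

/-! ### Uniqueness of ∂G/∂h. -/

theorem dOne_dTwo_linear {A B : PhaseSpace → ℂ} {p : PhaseSpace}
    (hA : DifferentiableAt ℂ A p) (hB : DifferentiableAt ℂ B p) :
    dOne (fun p => p.1.1 * A p + p.1.2 * B p) p =
      A p + p.1.1 * dOne A p + p.1.2 * dOne B p ∧
    dTwo (fun p => p.1.1 * A p + p.1.2 * B p) p =
      B p + p.1.1 * dTwo A p + p.1.2 * dTwo B p := by
  have du := (analyticAt_coord_one p).differentiableAt
  have dv := (analyticAt_coord_two p).differentiableAt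
  have m1 := dOne_dTwo_mul du hA
  have m2 := dOne_dTwo_mul dv hB
  have m3 := dOne_dTwo_add (f := fun p => p.1.1 * A p) (g := fun p => p.1.2 * B p)
    (du.mul hA) (dv.mul hB)
  constructor
  · rw [m3.1, m1.1, m2.1]
    simp
    ring
  · rw [m3.2, m1.2, m2.2]
    simp
    ring

theorem dOne_dTwo_mul_linear {g A B : PhaseSpace → ℂ} (hg : AnalyticAt ℂ g 0)
    (hA : AnalyticAt ℂ A 0) (hB : AnalyticAt ℂ B 0) :
    dOne (fun p => g p * (p.1.1 * A p + p.1.2 * B p)) 0 = g 0 * A 0 ∧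
    dTwo (fun p => g p * (p.1.1 * A p + p.1.2 * B p)) 0 = g 0 * B 0 := by
  have l := dOne_dTwo_linear hA.differentiableAt hB.differentiableAt
  have m := dOne_dTwo_mul (g := fun p => p.1.1 * A p + p.1.2 * B p) hg.differentiableAt
    (((analyticAt_coord_one 0).mul hA).add ((analyticAt_coord_two 0).mul hB)).differentiableAt
  constructor
  · rw [m.1, l.1]
    simp
  · rw [m.2, l.2]
    simp

theorem zero_prodUV_fibered : ((prodUV 0, (0 : PhaseSpace).2) : Base) = 0 :=
  fibered_zero (by simp [prodUV])

/-- `(Φ, G)` normalizes `H`, up to a function of the parameters, over the parameters in `S`. -/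
structure NormalizesOn (S : Set (ℂ × ℂ)) (H : PhaseSpace → ℂ) (Φ : PhaseSpace → Plane)
    (G : Base → ℂ) : Prop where
  symplectic : IsTransverselySymplectic Φ
  analytic : AnalyticAt ℂ G 0
  normal_form : ∃ c : ℂ × ℂ → ℂ, ∀ᶠ p in 𝓝 (0 : PhaseSpace),
    p.2 ∈ S → H (Φ p, p.2) = G (prodUV p, p.2) + c p.2

/-- The Hessian determinant of a Hamiltonian is minus the squared frequency of its normal form. -/
theorem NormalizesOn.hessian_det {S : Set (ℂ × ℂ)} (hS : 0 ∈ S) {H : PhaseSpace → ℂ}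
    (hH : AnalyticAt ℂ H 0) {Φ : PhaseSpace → Plane} {G : Base → ℂ} (h : NormalizesOn S H Φ G) :
    (hessian H 0).det = -(partialH G 0) ^ 2 := by
  obtain ⟨hΦ, hG, c, hc⟩ := h
  set X : PhaseSpace → ℂ := fun p => (Φ p).1 with hX
  set Y : PhaseSpace → ℂ := fun p => (Φ p).2 with hY
  have aX : AnalyticAt ℂ X 0 := analyticAt_fst.comp hΦ.analytic
  have aY : AnalyticAt ℂ Y 0 := analyticAt_snd.comp hΦ.analytic
  have h0 : prodUV 0 = 0 := by simp [prodUV]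
  have hGt := tendsto_fibered (analyticAt_prodUV 0) h0
  have aHΦ : AnalyticAt ℂ (fun p : PhaseSpace => H (Φ p, p.2)) 0 := hΦ.analyticAt_comp hH
  have aGh : AnalyticAt ℂ (fun p : PhaseSpace => G (prodUV p, p.2)) 0 :=
    analyticAt_fibered_comp (analyticAt_prodUV 0) h0 hG
  set g : PhaseSpace → ℂ := fun p => partialH G (prodUV p, p.2) with hg
  have ag : AnalyticAt ℂ g 0 := analyticAt_fibered_comp (analyticAt_prodUV 0) h0
    (analyticAt_partialH hG)
  -- The differentiated normal form, solved for the gradient of H by Cramer's rule with determinant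
  -- one. The right-hand sides are combinations of u₁ and u₂, so one more differentiation at 0
  -- involves no second derivative of Φ.
  have key : ∀ᶠ p in 𝓝 (0 : PhaseSpace), p.2 ∈ S →
      dOne H (Φ p, p.2) = g p * (p.1.2 * dTwo Y p - p.1.1 * dOne Y p) + 0 ∧
      dTwo H (Φ p, p.2) = g p * (p.1.1 * dOne X p - p.1.2 * dTwo X p) + 0 := by
    filter_upwards [eventually_dOne_dTwo_eq aHΦ aGh hc, hΦ.eventually_jac,
      hΦ.analytic.eventually_analyticAt, hΦ.tendsto.eventually hH.eventually_analyticAt,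
      hGt.eventually hG.eventually_analyticAt] with p h1 h2 h3 h4 h5 hp
    obtain ⟨e1, e2⟩ := h1 hp
    rw [jac_eq h3.differentiableAt] at h2
    obtain ⟨f1, f2⟩ := dOne_dTwo_comp h4.differentiableAt h3.differentiableAt
    obtain ⟨k1, k2⟩ := dOne_dTwo_base (f := prodUV) h5.differentiableAt
      (analyticAt_prodUV p).differentiableAt
    rw [f1, k1, dOne_prodUV] at e1
    rw [f2, k2, dTwo_prodUV] at e2
    constructor
    · linear_combination dTwo Y p * e1 - dOne Y p * e2 - dOne H (Φ p, p.2) * h2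
    · linear_combination dOne X p * e2 - dTwo X p * e1 - dTwo H (Φ p, p.2) * h2
  have au := analyticAt_coord_one 0
  have av := analyticAt_coord_two 0
  have aE1 : AnalyticAt ℂ (fun p : PhaseSpace => p.1.2 * dTwo Y p - p.1.1 * dOne Y p) 0 :=
    (av.mul aY.dTwo).sub (au.mul aY.dOne)
  have aE2 : AnalyticAt ℂ (fun p : PhaseSpace => p.1.1 * dOne X p - p.1.2 * dTwo X p) 0 :=
    (au.mul aX.dOne).sub (av.mul aX.dTwo)
  have s1 := (eventually_dOne_dTwo_eq (c := fun _ => 0) (hΦ.analyticAt_comp hH.dOne) (ag.mul aE1)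
    (key.mono fun p h hp => (h hp).1)).self_of_nhds hS
  have s2 := (eventually_dOne_dTwo_eq (c := fun _ => 0) (hΦ.analyticAt_comp hH.dTwo) (ag.mul aE2)
    (key.mono fun p h hp => (h hp).2)).self_of_nhds hS
  have l1 := dOne_dTwo_mul_linear ag aY.dOne.neg aY.dTwo
  have l2 := dOne_dTwo_mul_linear ag aX.dOne aX.dTwo.neg
  have e1 : (g * fun p : PhaseSpace => p.1.2 * dTwo Y p - p.1.1 * dOne Y p) =
      fun p => g p * (p.1.1 * (-dOne Y) p + p.1.2 * dTwo Y p) := by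
    funext p; simp only [Pi.mul_apply, Pi.neg_apply]; ring
  have e2 : (g * fun p : PhaseSpace => p.1.1 * dOne X p - p.1.2 * dTwo X p) =
      fun p => g p * (p.1.1 * dOne X p + p.1.2 * (-dTwo X) p) := by
    funext p; simp only [Pi.mul_apply, Pi.neg_apply]; ring
  rw [e1, l1.1, l1.2] at s1
  rw [e2, l2.1, l2.2] at s2
  have hj := hΦ.eventually_jac.self_of_nhds
  rw [jac_eq hΦ.analytic.differentiableAt] at hj
  have hd : ∀ f : PhaseSpace → ℂ, AnalyticAt ℂ f 0 →
      DifferentiableAt ℂ f (Φ 0, (0 : PhaseSpace).2) := fun f hf => by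
    rw [fibered_zero hΦ.map_zero]; exact hf.differentiableAt
  have c1 := dOne_dTwo_comp (hd _ hH.dOne) hΦ.analytic.differentiableAt
  have c2 := dOne_dTwo_comp (hd _ hH.dTwo) hΦ.analytic.differentiableAt
  rw [c1.1, c1.2, fibered_zero hΦ.map_zero] at s1
  rw [c2.1, c2.2, fibered_zero hΦ.map_zero] at s2
  rw [hessian_det_eq hH]
  have hg0 : g 0 = partialH G 0 := by rw [hg]; exact congrArg (partialH G) zero_prodUV_fibered
  rw [hg0] at s1 s2
  obtain ⟨a1, a2⟩ := s1
  obtain ⟨b1, b2⟩ := s2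
  set X1 := dOne X 0
  set X2 := dTwo X 0
  set Y1 := dOne Y 0
  set Y2 := dTwo Y 0
  set g0 := partialH G 0
  have hj' : X1 * Y2 - X2 * Y1 = 1 := hj
  set H11 := dOne (dOne H) 0
  set H12 := dTwo (dOne H) 0
  set H21 := dOne (dTwo H) 0
  set H22 := dTwo (dTwo H) 0
  -- Determinants in the identity Hess(H) · DΦ = g₀ · N, where N has rows (-Y₁, Y₂), (X₁, -X₂) and
  -- determinant -1.
  have prod_eq : (H11 * H22 - H21 * H12) * (X1 * Y2 - X2 * Y1)
      = (g0 * -Y1) * (g0 * -X2) - (g0 * X1) * (g0 * Y2) := by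
    have a1' : _ = g0 * -Y1 := a1
    have b2' : _ = g0 * -X2 := b2
    rw [← a1', ← a2, ← b1, ← b2']; ring
  rw [hj', mul_one] at prod_eq
  rw [prod_eq]
  linear_combination -g0 ^ 2 * hj'

theorem eq_const_of_hasDerivAt_zero {f : ℝ → ℂ} (h : ∀ θ, HasDerivAt f 0 θ) (θ : ℝ) :
    f θ = f 0 :=
  is_const_of_deriv_eq_zero (fun θ => (h θ).differentiableAt) (fun θ => (h θ).deriv) θ 0

/-- If a nonvanishing function is multiplied by a constant rate `m` along the circle action, then
`m` is an integer. -/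
theorem exists_int_of_euler_eq {f : PhaseSpace → ℂ} {p : PhaseSpace} {m : ℂ}
    (hf : ∀ θ : ℝ, DifferentiableAt ℂ f (flow (θ * Complex.I) p))
    (hE : ∀ θ : ℝ, euler f (flow (θ * Complex.I) p) = m * f (flow (θ * Complex.I) p))
    (hp : f p ≠ 0) : ∃ n : ℤ, m = n := by
  -- Along the orbit f evolves like exp(imθ), which the second factor cancels. Comparing θ = 0 with
  -- θ = 2π gives exp(-2πim) = 1.
  let F : ℝ → ℂ := fun θ => f (flow (θ * Complex.I) p) * Complex.exp (-(m * (θ * Complex.I)))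
  have hF : ∀ θ, HasDerivAt F 0 θ := by
    intro θ
    have h1 := hasDerivAt_flow_mul_I (hf θ)
    rw [hE θ] at h1
    have h2 : HasDerivAt (fun θ : ℝ => Complex.exp (-(m * (θ * Complex.I))))
        (Complex.exp (-(m * (θ * Complex.I))) * (-(m * Complex.I))) θ := by
      have h3 : HasDerivAt (fun θ : ℝ => -(m * (θ * Complex.I))) (-(m * Complex.I)) θ := by
        simpa using (((Complex.ofRealCLM.hasDerivAt (x := θ)).mul_const Complex.I).const_mul m).fun_neg
      exact h3.cexp
    refine (h1.mul h2).congr_deriv ?_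
    ring
  have h := eq_const_of_hasDerivAt_zero hF (2 * Real.pi)
  simp only [F, Complex.ofReal_mul, Complex.ofReal_ofNat, flow_two_pi, Complex.ofReal_zero,
    zero_mul, flow_zero, mul_zero, neg_zero, Complex.exp_zero, mul_one] at h
  have h' : Complex.exp (-(m * (2 * Real.pi * Complex.I))) = 1 :=
    mul_left_cancel₀ hp (by rw [h, mul_one])
  obtain ⟨n, hn⟩ := Complex.exp_eq_one_iff.1 h'
  refine ⟨-n, ?_⟩
  have h2 : (2 * Real.pi * Complex.I : ℂ) ≠ 0 := Complex.two_pi_I_ne_zero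
  apply mul_right_cancel₀ h2
  push_cast
  linear_combination -hn

/-- The return of the circle action after 2π forces the ratio of the two frequencies to be an
integer, and `h0` singles out 1. The argument runs inside one fibre at a time, on a ball independent
of the fibre, so S can be arbitrary. -/
theorem partialH_eq_of_conjugate {S : Set (ℂ × ℂ)} {ψ : PhaseSpace → Plane}
    (hψ : IsTransverselySymplectic ψ) {G₁ G₂ : Base → ℂ} (hG₁ : AnalyticAt ℂ G₁ 0)
    (hG₂ : AnalyticAt ℂ G₂ 0) {c : ℂ × ℂ → ℂ}
    (h : ∀ᶠ p in 𝓝 (0 : PhaseSpace), p.2 ∈ S →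
      G₁ (prodUV (ψ p, p.2), p.2) = G₂ (prodUV p, p.2) + c p.2)
    (h0 : partialH G₁ 0 = partialH G₂ 0) (hne : partialH G₂ 0 ≠ 0) :
    ∀ᶠ q in 𝓝 (0 : Base), q.2 ∈ S → partialH G₁ q = partialH G₂ q := by
  set X : PhaseSpace → ℂ := fun p => (ψ p).1 with hX
  set Y : PhaseSpace → ℂ := fun p => (ψ p).2 with hY
  set k : PhaseSpace → ℂ := fun p => prodUV (ψ p, p.2) with hk
  have hkXY : k = fun p => X p * Y p := rfl
  have h00 : prodUV 0 = 0 := by simp [prodUV]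
  have ak : AnalyticAt ℂ k 0 := hψ.analyticAt_comp (analyticAt_prodUV 0)
  have hk0 : k 0 = 0 := by simp only [hk, fibered_zero hψ.map_zero, h00]
  have ht1 := tendsto_fibered ak hk0
  have ht2 := tendsto_fibered (analyticAt_prodUV 0) h00
  set g₁ : PhaseSpace → ℂ := fun p => partialH G₁ (k p, p.2) with hg₁
  set g₂ : PhaseSpace → ℂ := fun p => partialH G₂ (prodUV p, p.2) with hg₂
  have ag₁ : AnalyticAt ℂ g₁ 0 := analyticAt_fibered_comp ak hk0 (analyticAt_partialH hG₁)
  have ag₂ : AnalyticAt ℂ g₂ 0 :=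
    analyticAt_fibered_comp (analyticAt_prodUV 0) h00 (analyticAt_partialH hG₂)
  have hg₁0 : g₁ 0 = partialH G₁ 0 := by simp only [hg₁, fibered_zero hk0]
  have hg₂0 : g₂ 0 = partialH G₂ 0 := by simp only [hg₂, fibered_zero h00]
  have hg₁ne : g₁ 0 ≠ 0 := by rw [hg₁0, h0]; exact hne
  have hg₂ne : g₂ 0 ≠ 0 := by rw [hg₂0]; exact hne
  have am : AnalyticAt ℂ (fun p => g₁ p / g₂ p) 0 := ag₁.div ag₂ hg₂ne
  -- The only integer at distance less than 1 from 1 is 1 itself.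
  have hm1 : ∀ᶠ p in 𝓝 (0 : PhaseSpace), ‖g₁ p / g₂ p - 1‖ < 1 := by
    refine (am.continuousAt.sub continuousAt_const).norm.eventually_lt continuousAt_const ?_
    simp [hg₁0, hg₂0, h0, hne]
  have hd := eventually_dOne_dTwo_eq (analyticAt_fibered_comp ak hk0 hG₁)
    (analyticAt_fibered_comp (analyticAt_prodUV 0) h00 hG₂) h
  obtain ⟨δ, hδ, hball⟩ := Metric.eventually_nhds_iff_ball.1
    (hd.and (hψ.eventually_jac.and (hψ.analytic.eventually_analyticAt.and
    ((ht1.eventually hG₁.eventually_analyticAt).and ((ht2.eventually hG₂.eventually_analyticAt).and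
    ((ag₁.continuousAt.eventually_ne hg₁ne).and ((ag₂.continuousAt.eventually_ne hg₂ne).and
    (hm1.and am.eventually_analyticAt))))))))
  simp only [mem_ball_zero_iff] at hball
  have dX : ∀ p : PhaseSpace, ‖p‖ < δ → DifferentiableAt ℂ X p := fun p hp =>
    ((hball p hp).2.2.1).differentiableAt.fst
  have dY : ∀ p : PhaseSpace, ‖p‖ < δ → DifferentiableAt ℂ Y p := fun p hp =>
    ((hball p hp).2.2.1).differentiableAt.snd
  have dk : ∀ p : PhaseSpace, ‖p‖ < δ → DifferentiableAt ℂ k p := fun p hp =>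
    (dX p hp).mul (dY p hp)
  have hflow : ∀ (θ : ℝ) (p : PhaseSpace), ‖p‖ < δ → ‖flow (θ * Complex.I) p‖ < δ :=
    fun θ p hp => by rwa [norm_flow]
  -- the chain rule turns the conjugacy into algebraic relations between first derivatives
  have rel : ∀ p : PhaseSpace, ‖p‖ < δ → p.2 ∈ S →
      g₁ p * dOne k p = g₂ p * p.1.2 ∧ g₁ p * dTwo k p = g₂ p * p.1.1 ∧
      g₁ p * X p = g₂ p * euler X p := by
    intro p hp hpS
    obtain ⟨h1, h2, h3, h4, h5, -⟩ := hball p hp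
    obtain ⟨e1, e2⟩ := h1 hpS
    rw [jac_eq h3.differentiableAt] at h2
    obtain ⟨k1, k2⟩ := dOne_dTwo_base (f := k) h4.differentiableAt (dk p hp)
    obtain ⟨l1, l2⟩ := dOne_dTwo_base (f := prodUV) h5.differentiableAt
      (analyticAt_prodUV p).differentiableAt
    rw [k1, l1, dOne_prodUV] at e1
    rw [k2, l2, dTwo_prodUV] at e2
    obtain ⟨n1, n2⟩ := dOne_dTwo_mul (dX p hp) (dY p hp)
    have n1' : dOne k p = _ := n1
    have n2' : dTwo k p = _ := n2
    refine ⟨e1, e2, ?_⟩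
    rw [n1'] at e1
    rw [n2'] at e2
    simp only [euler]
    linear_combination dOne X p * e2 - dTwo X p * e1 - g₁ p * X p * h2
  have hkflow : ∀ (θ : ℝ) (p : PhaseSpace), ‖p‖ < δ → p.2 ∈ S → k (flow (θ * Complex.I) p) = k p := by
    intro θ p hp hpS
    have := eq_const_of_hasDerivAt_zero (f := fun θ : ℝ => k (flow (θ * Complex.I) p))
      (fun θ => ?_) θ
    · simpa using this
    · refine (hasDerivAt_flow_mul_I (dk _ (hflow θ p hp))).congr_deriv ?_
      obtain ⟨r1, r2, -⟩ := rel _ (hflow θ p hp) hpS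
      have hne := (hball _ (hflow θ p hp)).2.2.2.2.2.1
      have : euler k (flow (θ * Complex.I) p) = 0 := by
        apply mul_left_cancel₀ hne
        simp only [euler]
        linear_combination (flow (θ * Complex.I) p).1.1 * r1 - (flow (θ * Complex.I) p).1.2 * r2
      rw [this, mul_zero]
  have hm_of_ne : ∀ p : PhaseSpace, ‖p‖ < δ → p.2 ∈ S → X p ≠ 0 → g₁ p / g₂ p = 1 := by
    intro p hp hpS hXp
    obtain ⟨n, hn⟩ := exists_int_of_euler_eq (f := X) (m := g₁ p / g₂ p)
      (fun θ => dX _ (hflow θ p hp)) (fun θ => by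
        have r := (rel _ (hflow θ p hp) hpS).2.2
        have e1 : g₁ (flow (θ * Complex.I) p) = g₁ p := by
          simp only [hg₁, hkflow θ p hp hpS, flow_snd]
        have e2 : g₂ (flow (θ * Complex.I) p) = g₂ p := by
          simp only [hg₂, prodUV_flow, flow_snd]
        have hne := (hball p hp).2.2.2.2.2.2.1
        rw [e1, e2] at r
        field_simp
        rw [r, mul_comm]) hXp
    have hlt := (hball p hp).2.2.2.2.2.2.2.1
    rw [hn] at hlt ⊢
    have : ‖((n - 1 : ℤ) : ℂ)‖ < 1 := by push_cast; exact hlt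
    rw [Complex.norm_intCast] at this
    have h3 : |n - 1| < 1 := by exact_mod_cast this
    have : n = 1 := by rw [abs_lt] at h3; omega
    simp [this]
  have hm : ∀ p : PhaseSpace, ‖p‖ < δ → p.2 ∈ S → g₁ p = g₂ p := by
    intro p hp hpS
    obtain ⟨-, hj, -, -, -, -, hne, -, ham⟩ := hball p hp
    by_contra hcon
    have hm1 : g₁ p / g₂ p ≠ 1 := fun e => hcon (by rwa [div_eq_one_iff_eq hne] at e)
    have hc : ContinuousAt (fun u : Plane => ((u, p.2) : PhaseSpace)) p.1 := by fun_prop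
    -- If the ratio differs from 1 at p, it does so nearby, and X would vanish on an open subset of
    -- the fibre, contradicting Jacobian one.
    have hev : ∀ᶠ u in 𝓝 p.1, X (u, p.2) = (fun _ : PhaseSpace => (0 : ℂ)) (u, p.2) + 0 := by
      have o1 : ∀ᶠ p' in 𝓝 p, ‖p'‖ < δ := continuousAt_id.norm.eventually_lt continuousAt_const hp
      filter_upwards [hc.eventually o1, hc.eventually (ham.continuousAt.eventually_ne hm1)]
        with u hu1 hu2
      by_contra hX0
      exact hu2 (hm_of_ne _ hu1 hpS (by simpa using hX0))
    obtain ⟨z1, z2⟩ := dOne_dTwo_eq_of_fiber (dX p hp) (differentiableAt_const _) hev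
    rw [jac_eq ((hball p hp).2.2.1).differentiableAt] at hj
    have w1 : dOne X p = 0 := by rw [z1]; simp [dOne]
    have w2 : dTwo X p = 0 := by rw [z2]; simp [dTwo]
    rw [show dOne (fun p => (ψ p).1) p = 0 from w1, show dTwo (fun p => (ψ p).1) p = 0 from w2] at hj
    simp at hj
  have hkh : ∀ p : PhaseSpace, ‖p‖ < δ → p.2 ∈ S → k p = prodUV p := by
    intro p hp hpS
    have hconst := sub_eq_sub_of_dOne_dTwo_eq dk
      (fun q _ => (analyticAt_prodUV q).differentiableAt) hp fun u hu => by
        obtain ⟨r1, r2, -⟩ := rel _ hu hpS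
        have hne := (hball _ hu).2.2.2.2.2.2.1
        rw [hm _ hu hpS] at r1 r2
        rw [dOne_prodUV, dTwo_prodUV]
        exact ⟨mul_left_cancel₀ hne r1, mul_left_cancel₀ hne r2⟩
    have hz : ‖((0, p.2) : PhaseSpace)‖ < δ :=
      max_lt (by simpa using hδ) ((norm_snd_le p).trans_lt hp)
    -- On the zero section E X = 0, so the relation g₁ X = g₂ E X kills X and fixes the constant k -
    -- u₁u₂ to be 0.
    have hX0 : X (0, p.2) = 0 := by
      have r := (rel _ hz hpS).2.2
      have hne := (hball _ hz).2.2.2.2.2.1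
      refine mul_left_cancel₀ hne (r.trans ?_)
      simp [euler]
    have hk0' : k (0, p.2) = 0 := by rw [hkXY]; simp [hX0]
    have hh0 : prodUV (0, p.2) = 0 := by simp [prodUV]
    rw [hk0', hh0, sub_zero] at hconst
    exact sub_eq_zero.1 hconst
  have hη : (0 : ℝ) < δ / 2 := by positivity
  set η : ℂ := ((δ / 2 : ℝ) : ℂ) with hηdef
  have hηne : η ≠ 0 := by rw [hηdef]; exact_mod_cast hη.ne'
  have hηnorm : ‖η‖ < δ := by
    rw [hηdef, Complex.norm_real, Real.norm_eq_abs, abs_of_pos hη]; linarith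
  -- The section h ↦ (h/η, η) of u₁u₂ reaches every small h from inside the ball and transfers the
  -- identity to (h, x, ε).
  have hc : ContinuousAt (fun q : Base => ((((q.1 / η, η) : Plane), q.2) : PhaseSpace)) 0 := by
    fun_prop
  have hev := hc.norm.eventually_lt (continuousAt_const (y := δ)) (by
    simp only [Prod.norm_def, Prod.fst_zero, Prod.snd_zero, zero_div, norm_zero]
    simp [hηnorm])
  filter_upwards [hev] with q hq hqS
  have e1 := hm _ hq hqS
  have e2 := hkh _ hq hqS
  have e3 : prodUV ((q.1 / η, η), q.2) = q.1 := by simp [prodUV, hηne]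
  simp only [hg₁, hg₂, e2, e3] at e1
  exact e1

/-! ### The polar locus and remainders modulo x(x-ε). -/

/-- The parameters `(x, ε)` with `x(x-ε) = 0`. -/
def polarLocus : Set (ℂ × ℂ) := {q | q.1 * (q.1 - q.2) = 0}

theorem zero_mem_polarLocus : 0 ∈ polarLocus := by simp [polarLocus]

/-- Newton interpolation at the nodes 0 and ε: Hadamard division by x, then of the quotient by x -
ε. Confluence of the nodes at ε = 0 needs no separate treatment. -/
theorem exists_isRemainder {g : Base → ℂ} (hg : AnalyticAt ℂ g 0) : ∃ χ, IsRemainder g χ := by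
  let L₁ : Base →L[ℂ] ℂ :=
    (ContinuousLinearMap.fst ℂ ℂ ℂ).comp (ContinuousLinearMap.snd ℂ ℂ (ℂ × ℂ))
  let L₂ : Base →L[ℂ] ℂ := L₁ -
    (ContinuousLinearMap.snd ℂ ℂ ℂ).comp (ContinuousLinearMap.snd ℂ ℂ (ℂ × ℂ))
  obtain ⟨Q₁, hQ₁, h₁⟩ := hg.exists_sub_eq_mul L₁ ((0, 1, 0) : Base)
  obtain ⟨Q, hQ, h₂⟩ := hQ₁.exists_sub_eq_mul L₂ ((0, 1, 0) : Base)
  have i₀ : AnalyticAt ℂ (fun q : ℂ × ℂ => ((q.1, 0, q.2) : Base)) 0 :=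
    analyticAt_fst.prod (analyticAt_const.prod analyticAt_snd)
  have i₁ : AnalyticAt ℂ (fun q : ℂ × ℂ => ((q.1, q.2, q.2) : Base)) 0 :=
    analyticAt_fst.prod (analyticAt_snd.prod analyticAt_snd)
  refine ⟨fun q => g (q.1, 0, q.2.2) + q.2.1 * Q₁ (q.1, q.2.2, q.2.2),
    fun q => g (q.1, 0, q.2), fun q => Q₁ (q.1, q.2, q.2), Q,
    hg.fun_comp_of_eq i₀ rfl, hQ₁.fun_comp_of_eq i₁ rfl, hQ, Eventually.of_forall fun _ => rfl, ?_⟩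
  filter_upwards [h₁, h₂] with q e₁ e₂
  have z₁ : q - L₁ q • ((0, 1, 0) : Base) = (q.1, 0, q.2.2) := by
    ext <;> simp [L₁]
  have z₂ : q - L₂ q • ((0, 1, 0) : Base) = (q.1, q.2.2, q.2.2) := by
    ext <;> simp [L₁, L₂]
  rw [z₁] at e₁
  rw [z₂] at e₂
  have l₁ : L₁ q = q.2.1 := rfl
  have l₂ : L₂ q = q.2.1 - q.2.2 := rfl
  rw [l₁] at e₁
  rw [l₂] at e₂
  linear_combination e₁ + q.2.1 * e₂

theorem IsRemainder.congr {g χ χ' : Base → ℂ} (h : IsRemainder g χ) (hχ : χ =ᶠ[𝓝 0] χ') :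
    IsRemainder g χ' := by
  obtain ⟨χ₀, χ₁, Q, h₀, h₁, hQ, e₁, e₂⟩ := h
  refine ⟨χ₀, χ₁, Q, h₀, h₁, hQ, ?_, ?_⟩
  · filter_upwards [e₁, hχ] with q a b
    rw [← b, a]
  · filter_upwards [e₂, hχ] with q a b
    rw [← b, a]

/-- A remainder is determined by the values of the dividend on the polar locus. -/
theorem IsRemainder.unique {g g' χ χ' : Base → ℂ} (h : IsRemainder g χ) (h' : IsRemainder g' χ')
    (hg : ∀ᶠ q in 𝓝 (0 : Base), q.2 ∈ polarLocus → g q = g' q) : χ =ᶠ[𝓝 0] χ' := by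
  obtain ⟨a₀, a₁, Q, ha₀, ha₁, -, ea, fa⟩ := h
  obtain ⟨b₀, b₁, R, hb₀, hb₁, -, eb, fb⟩ := h'
  have hS : ∀ᶠ q in 𝓝 (0 : Base), q.2 ∈ polarLocus →
      a₀ (q.1, q.2.2) + q.2.1 * a₁ (q.1, q.2.2) = b₀ (q.1, q.2.2) + q.2.1 * b₁ (q.1, q.2.2) := by
    filter_upwards [ea, fa, eb, fb, hg] with q e₁ e₂ e₃ e₄ e₅ hq
    have e₅ := e₅ hq
    have hq : q.2.1 * (q.2.1 - q.2.2) = 0 := hq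
    rw [e₂, e₄, hq, zero_mul, zero_mul, e₁, e₃] at e₅
    simpa using e₅
  have c₀ : Tendsto (fun q : ℂ × ℂ => ((q.1, 0, q.2) : Base)) (𝓝 0) (𝓝 0) :=
    Continuous.tendsto' (by fun_prop) _ _ rfl
  have c₁ : Tendsto (fun q : ℂ × ℂ => ((q.1, q.2, q.2) : Base)) (𝓝 0) (𝓝 0) :=
    Continuous.tendsto' (by fun_prop) _ _ rfl
  have h₀ : ∀ᶠ q in 𝓝 (0 : ℂ × ℂ), a₀ q = b₀ q := by
    filter_upwards [c₀.eventually hS] with q hq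
    simpa [polarLocus] using hq
  -- The node x = ε yields only ε a₁ = ε b₁; the hyperplane ε = 0 is filled in afterwards from its
  -- complement.
  have h₁ : ∀ᶠ q in 𝓝 (0 : ℂ × ℂ), q.2 ≠ 0 → a₁ q = b₁ q := by
    filter_upwards [c₁.eventually hS, h₀] with q hq h hne
    have := hq (by simp [polarLocus])
    simp only [Prod.mk.eta, h, add_right_inj] at this
    exact mul_left_cancel₀ hne this
  have h₁' : ∀ᶠ q in 𝓝 (0 : ℂ × ℂ), a₁ q = b₁ q := by
    have := (ha₁.sub hb₁).eventually_eq_zero_of_ne (ℓ := ContinuousLinearMap.snd ℂ ℂ ℂ)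
      (v := (0, 1)) rfl (h₁.mono fun q hq hne => sub_eq_zero.2 (hq hne))
    exact this.mono fun q hq => sub_eq_zero.1 hq
  have p : Tendsto (fun q : Base => ((q.1, q.2.2) : ℂ × ℂ)) (𝓝 0) (𝓝 0) :=
    Continuous.tendsto' (by fun_prop) _ _ rfl
  filter_upwards [ea, eb, p.eventually h₀, p.eventually h₁'] with q e₁ e₂ e₃ e₄
  rw [e₁, e₂, e₃, e₄]

/-! ### The involution and comparison of normal forms. -/

theorem analyticAt_neg_fst : AnalyticAt ℂ (fun q : Base => ((-q.1, q.2) : Base)) 0 :=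
  analyticAt_fst.neg.prod analyticAt_snd

theorem analyticAt_mirror {G : Base → ℂ} (hG : AnalyticAt ℂ G 0) : AnalyticAt ℂ (mirror G) 0 :=
  hG.fun_comp_of_eq analyticAt_neg_fst (by simp)

theorem partialH_mirror (G : Base → ℂ) : partialH (mirror G) = reflection (partialH G) := by
  funext q
  exact deriv_comp_neg (fun t : ℂ => G (t, q.2)) q.1

theorem IsRemainder.reflection {g χ : Base → ℂ} (h : IsRemainder g χ) :
    IsRemainder (reflection g) (reflection χ) := by
  obtain ⟨χ₀, χ₁, Q, h₀, h₁, hQ, e₁, e₂⟩ := h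
  have i : AnalyticAt ℂ (fun q : ℂ × ℂ => ((-q.1, q.2) : ℂ × ℂ)) 0 :=
    analyticAt_fst.neg.prod analyticAt_snd
  have t : Tendsto (fun q : Base => ((-q.1, q.2) : Base)) (𝓝 0) (𝓝 0) :=
    Continuous.tendsto' (by fun_prop) _ _ (by simp)
  refine ⟨fun q => -χ₀ (-q.1, q.2), fun q => -χ₁ (-q.1, q.2), fun q => -Q (-q.1, q.2),
    (h₀.fun_comp_of_eq i (by simp)).neg, (h₁.fun_comp_of_eq i (by simp)).neg,
    (hQ.fun_comp_of_eq analyticAt_neg_fst (by simp)).neg, ?_, ?_⟩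
  · filter_upwards [t.eventually e₁] with q hq
    simp only [ConfluentHamiltonian.reflection, hq]
    ring
  · filter_upwards [t.eventually e₂] with q hq
    simp only [ConfluentHamiltonian.reflection, hq]
    ring

theorem tendsto_rotJ : Tendsto rotJ (𝓝 0) (𝓝 0) :=
  Continuous.tendsto' (by unfold rotJ; fun_prop) _ _ (by simp [rotJ])

theorem NormalizesOn.mirror {S : Set (ℂ × ℂ)} {H : PhaseSpace → ℂ} {Φ : PhaseSpace → Plane}
    {G : Base → ℂ} (h : NormalizesOn S H Φ G) : NormalizesOn S H (Φ ∘ rotJ) (mirror G) := by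
  obtain ⟨hΦ, hG, c, hc⟩ := h
  refine ⟨hΦ.comp_rotJ, analyticAt_mirror hG, c, ?_⟩
  filter_upwards [tendsto_rotJ.eventually hc] with p hp hpS
  have e : -prodUV p = prodUV (rotJ p) := by simp only [prodUV, rotJ]; ring
  simp only [ConfluentHamiltonian.mirror, e]
  exact hp hpS

theorem IsBirkhoffSiegel.mirror {H : PhaseSpace → ℂ} {Φ : PhaseSpace → Plane}
    {G : Base → ℂ} (h : IsBirkhoffSiegel H Φ G) : IsBirkhoffSiegel H (Φ ∘ rotJ) (mirror G) := by
  obtain ⟨hΦ, hG, hc⟩ := h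
  refine ⟨hΦ.comp_rotJ, analyticAt_mirror hG, ?_⟩
  filter_upwards [tendsto_rotJ.eventually hc] with p hp
  have e : -(p.1.1 * p.1.2) = (rotJ p).1.1 * (rotJ p).1.2 := by simp only [rotJ]; ring
  simp only [ConfluentHamiltonian.mirror, e]
  exact hp

theorem IsBirkhoffSiegel.normalizesOn {H : PhaseSpace → ℂ} {Φ : PhaseSpace → Plane}
    {G : Base → ℂ} (h : IsBirkhoffSiegel H Φ G) (S : Set (ℂ × ℂ)) : NormalizesOn S H Φ G :=
  ⟨h.symplectic, h.analytic, 0, h.normal_form.mono fun p hp _ => by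
    rw [hp, Pi.zero_apply, add_zero]; rfl⟩

/-- The transition germ Φ₁⁻¹∘Φ₂ is symplectic and conjugates one normal form to the other over S. -/
theorem NormalizesOn.partialH_eq {S : Set (ℂ × ℂ)} {H : PhaseSpace → ℂ}
    {Φ₁ Φ₂ : PhaseSpace → Plane} {G₁ G₂ : Base → ℂ} (h₁ : NormalizesOn S H Φ₁ G₁)
    (h₂ : NormalizesOn S H Φ₂ G₂) (h0 : partialH G₁ 0 = partialH G₂ 0)
    (hne : partialH G₂ 0 ≠ 0) :
    ∀ᶠ q in 𝓝 (0 : Base), q.2 ∈ S → partialH G₁ q = partialH G₂ q := by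
  obtain ⟨hΦ₁, hG₁, c₁, hc₁⟩ := h₁
  obtain ⟨hΦ₂, hG₂, c₂, hc₂⟩ := h₂
  obtain ⟨Ψ, hΨ, hr⟩ := hΦ₁.exists_inverse
  have hψ := hΨ.comp hΦ₂
  refine partialH_eq_of_conjugate hψ hG₁ hG₂ (c := c₂ - c₁) ?_ h0 hne
  filter_upwards [hψ.tendsto.eventually hc₁, hc₂, hΦ₂.tendsto.eventually hr] with p e₁ e₂ e₃ hp
  have e₁ := e₁ hp
  have e₂ := e₂ hp
  rw [e₃, e₂] at e₁
  rw [Pi.sub_apply]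
  linear_combination -e₁

/-- The common Hessian determinant fixes the frequency at the origin up to sign. If the signs
differ, replacing G₂ by its mirror makes them agree, and uniqueness applies. -/
theorem NormalizesOn.isRemainder {H : PhaseSpace → ℂ} (hH : IsHamiltonian H)
    {Φ₁ Φ₂ : PhaseSpace → Plane} {G₁ G₂ : Base → ℂ} (h₁ : NormalizesOn polarLocus H Φ₁ G₁)
    (h₂ : NormalizesOn polarLocus H Φ₂ G₂) {χ : Base → ℂ} (hχ : IsRemainder (partialH G₁) χ) :
    IsRemainder (partialH G₂) χ ∨ IsRemainder (partialH (ConfluentHamiltonian.mirror G₂)) χ := by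
  have d₁ := h₁.hessian_det zero_mem_polarLocus hH.analytic
  have d₂ := h₂.hessian_det zero_mem_polarLocus hH.analytic
  have hne : partialH G₂ 0 ≠ 0 := by
    intro h
    rw [h] at d₂
    exact hH.nondegenerate (by simpa using d₂)
  have hsq : partialH G₁ 0 ^ 2 = partialH G₂ 0 ^ 2 :=
    neg_injective (d₁.symm.trans d₂)
  have key : ∀ {Φ : PhaseSpace → Plane} {G : Base → ℂ}, NormalizesOn polarLocus H Φ G →
      partialH G₁ 0 = partialH G 0 → partialH G 0 ≠ 0 → IsRemainder (partialH G) χ := by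
    intro Φ G h h0 hne
    obtain ⟨χ', hχ'⟩ := exists_isRemainder (analyticAt_partialH h.analytic)
    have e := h₁.partialH_eq h h0 hne
    exact hχ'.congr (hχ.unique hχ' e).symm
  rcases sq_eq_sq_iff_eq_or_eq_neg.1 hsq with h | h
  · exact Or.inl (key h₂ h hne)
  · have h0 : partialH (ConfluentHamiltonian.mirror G₂) 0 = -partialH G₂ 0 := by
      rw [partialH_mirror]
      simp only [ConfluentHamiltonian.reflection, Prod.fst_zero, neg_zero]
      rfl
    exact Or.inr (key h₂.mirror (h.trans h0.symm) (by rw [h0]; exact neg_ne_zero.2 hne))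

/-- The transfer principle behind invariance: a normal form of K may replace that of H once it also
normalizes H over the polar locus, possibly through a different Φ₂. -/
theorem IsFormalInvariant.of_normalizesOn {H K : PhaseSpace → ℂ} (hH : IsHamiltonian H)
    {Φ₁ Φ₂ Φ : PhaseSpace → Plane} {G₁ G₂ : Base → ℂ} (h₁ : NormalizesOn polarLocus H Φ₁ G₁)
    (h₂ : NormalizesOn polarLocus H Φ₂ G₂) (h : IsBirkhoffSiegel K Φ G₂) {χ : Base → ℂ}
    (hχ : IsRemainder (partialH G₁) χ) : IsFormalInvariant K χ := by
  rcases h₁.isRemainder hH h₂ hχ with h' | h'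
  · exact ⟨_, _, h, h'⟩
  · exact ⟨_, _, h.mirror, h'⟩

/-! ### Equal polar parts and transformed systems. -/

theorem SamePolarPart.symm {H K : PhaseSpace → ℂ} (h : SamePolarPart H K) : SamePolarPart K H := by
  obtain ⟨R, hR, h⟩ := h
  refine ⟨-R, hR.neg, h.mono fun p hp => ?_⟩
  rw [hp, Pi.neg_apply]
  ring

theorem SamePolarPart.normalizesOn {H K : PhaseSpace → ℂ} (h : SamePolarPart H K)
    {Φ : PhaseSpace → Plane} {G : Base → ℂ} (hK : IsBirkhoffSiegel K Φ G) :
    NormalizesOn polarLocus H Φ G := by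
  obtain ⟨R, -, h⟩ := h
  refine ⟨hK.symplectic, hK.analytic, 0, ?_⟩
  filter_upwards [hK.symplectic.tendsto.eventually h, hK.normal_form] with p e₁ e₂ hp
  have hp : p.2.1 * (p.2.1 - p.2.2) = 0 := hp
  rw [e₁, e₂]
  simp [hp, prodUV]

theorem exists_eq_add_of_dOne_dTwo_eq {f g : PhaseSpace → ℂ} {S : Set (ℂ × ℂ)}
    (hf : AnalyticAt ℂ f 0) (hg : AnalyticAt ℂ g 0)
    (h : ∀ᶠ p in 𝓝 (0 : PhaseSpace), p.2 ∈ S → dOne f p = dOne g p ∧ dTwo f p = dTwo g p) :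
    ∃ c : ℂ × ℂ → ℂ, ∀ᶠ p in 𝓝 (0 : PhaseSpace), p.2 ∈ S → f p = g p + c p.2 := by
  obtain ⟨δ, hδ, hball⟩ := Metric.eventually_nhds_iff_ball.1
    (h.and (hf.eventually_analyticAt.and hg.eventually_analyticAt))
  refine ⟨fun q => f (0, q) - g (0, q), ?_⟩
  filter_upwards [Metric.ball_mem_nhds (0 : PhaseSpace) hδ] with p hp hpS
  rw [mem_ball_zero_iff] at hp
  have hconst := sub_eq_sub_of_dOne_dTwo_eq
    (fun q hq => (hball q (mem_ball_zero_iff.2 hq)).2.1.differentiableAt)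
    (fun q hq => (hball q (mem_ball_zero_iff.2 hq)).2.2.differentiableAt) hp
    (fun u hu => (hball _ (mem_ball_zero_iff.2 hu)).1 hpS)
  linear_combination hconst

theorem fiberedMap_fderiv {Φ : PhaseSpace → Plane} {p : PhaseSpace}
    (hΦ : DifferentiableAt ℂ Φ p) :
    HasFDerivAt (fiberedMap Φ p.2.2)
      (((fderiv ℂ Φ p).comp ((ContinuousLinearMap.fst ℂ Plane ℂ).prod
        ((ContinuousLinearMap.snd ℂ Plane ℂ).prod 0))).prod (ContinuousLinearMap.snd ℂ Plane ℂ))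
      (p.1, p.2.1) := by
  have h1 : HasFDerivAt (fun q : Plane × ℂ => ((q.1, q.2, p.2.2) : PhaseSpace))
      ((ContinuousLinearMap.fst ℂ Plane ℂ).prod ((ContinuousLinearMap.snd ℂ Plane ℂ).prod 0))
      (p.1, p.2.1) :=
    hasFDerivAt_fst.prodMk (hasFDerivAt_snd.prodMk (hasFDerivAt_const _ _))
  exact (HasFDerivAt.comp (f := fun q : Plane × ℂ => ((q.1, q.2, p.2.2) : PhaseSpace))
    (p.1, p.2.1) hΦ.hasFDerivAt h1).prodMk hasFDerivAt_snd

/-- Over the polar locus both vector fields are tangent to the fibres and Hamiltonian there. A map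
of Jacobian one matching the fields also matches the differentials of H∘Φ and K, leaving only a
function of (x, ε). -/
theorem Transforms.normalizesOn {Φ : PhaseSpace → Plane} {H K : PhaseSpace → ℂ}
    (hH : AnalyticAt ℂ H 0) (hK : AnalyticAt ℂ K 0) (hΦ : IsTransverselySymplectic Φ)
    (hT : Transforms Φ H K) {Φ₂ : PhaseSpace → Plane} {G : Base → ℂ}
    (hG : IsBirkhoffSiegel K Φ₂ G) :
    NormalizesOn polarLocus H (fun p => Φ (Φ₂ p, p.2)) G := by
  have hd : ∀ᶠ p in 𝓝 (0 : PhaseSpace), p.2 ∈ polarLocus →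
      dOne (fun p => H (Φ p, p.2)) p = dOne K p ∧ dTwo (fun p => H (Φ p, p.2)) p = dTwo K p := by
    filter_upwards [hT, hΦ.eventually_jac, hΦ.analytic.eventually_analyticAt,
      hΦ.tendsto.eventually hH.eventually_analyticAt, hK.eventually_analyticAt]
      with p h1 h2 h3 h4 h5 hp
    have hF := fiberedMap_fderiv h3.differentiableAt
    set A := ((fderiv ℂ Φ p).comp ((ContinuousLinearMap.fst ℂ Plane ℂ).prod
        ((ContinuousLinearMap.snd ℂ Plane ℂ).prod 0))).prod (ContinuousLinearMap.snd ℂ Plane ℂ)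
      with hA
    have hX : fderiv ℂ (fun p => (Φ p).1) p =
      (ContinuousLinearMap.fst ℂ ℂ ℂ).comp (fderiv ℂ Φ p) := h3.differentiableAt.hasFDerivAt.fst.fderiv
    have hY : fderiv ℂ (fun p => (Φ p).2) p =
      (ContinuousLinearMap.snd ℂ ℂ ℂ).comp (fderiv ℂ Φ p) := h3.differentiableAt.hasFDerivAt.snd.fderiv
    have hAv : ∀ v : Plane, A (v, 0) =
        ((v.1 * dOne (fun p => (Φ p).1) p + v.2 * dTwo (fun p => (Φ p).1) p,
          v.1 * dOne (fun p => (Φ p).2) p + v.2 * dTwo (fun p => (Φ p).2) p), 0) := by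
      intro v
      rw [← fderiv_fiber_apply, ← fderiv_fiber_apply, hX, hY]
      rfl
    rw [jac_eq h3.differentiableAt] at h2
    -- `VectorField.pullback` uses `ContinuousLinearMap.inverse`, which is 0 by default on
    -- non-invertible maps; invertibility must be known before it can be undone.
    have hinj : Function.Injective (A : Plane × ℂ →ₗ[ℂ] Plane × ℂ) := by
      rw [← LinearMap.ker_eq_bot, LinearMap.ker_eq_bot']
      rintro ⟨v, ξ⟩ h
      have hξ : ξ = 0 := (Prod.ext_iff.1 h).2
      subst hξ
      have h := (hAv v).symm.trans h
      have e1 := (Prod.ext_iff.1 (Prod.ext_iff.1 h).1).1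
      have e2 := (Prod.ext_iff.1 (Prod.ext_iff.1 h).1).2
      simp only [Prod.fst_zero, Prod.snd_zero] at e1 e2
      ext
      · simp only [Prod.fst_zero]
        linear_combination dTwo (fun p => (Φ p).2) p * e1 - dTwo (fun p => (Φ p).1) p * e2 - v.1 * h2
      · simp only [Prod.fst_zero, Prod.snd_zero]
        linear_combination dOne (fun p => (Φ p).1) p * e2 - dOne (fun p => (Φ p).2) p * e1 - v.2 * h2
      · rfl
    let e : (Plane × ℂ) ≃L[ℂ] (Plane × ℂ) :=
      (LinearEquiv.ofInjectiveEndo (A : Plane × ℂ →ₗ[ℂ] Plane × ℂ) hinj).toContinuousLinearEquiv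
    have he : (e : Plane × ℂ →L[ℂ] Plane × ℂ) = A := by
      ext <;> rfl
    rw [VectorField.pullback, hF.fderiv, ← he, ContinuousLinearMap.inverse_equiv] at h1
    have h1' : vectorField H p.2.2 (fiberedMap Φ p.2.2 (p.1, p.2.1)) =
        A (vectorField K p.2.2 (p.1, p.2.1)) := by
      rw [← he, ← h1]
      exact (e.apply_symm_apply _).symm
    have hp : p.2.1 * (p.2.1 - p.2.2) = 0 := hp
    have hZH : vectorField H p.2.2 (fiberedMap Φ p.2.2 (p.1, p.2.1)) =
        ((dTwo H (Φ p, p.2), -dOne H (Φ p, p.2)), 0) := by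
      simp only [vectorField, fiberedMap, Prod.mk.eta, hp]
      rw [partialOne_eq_dOne h4.differentiableAt, partialTwo_eq_dTwo h4.differentiableAt]
    have hZK : vectorField K p.2.2 (p.1, p.2.1) = ((dTwo K p, -dOne K p), 0) := by
      simp only [vectorField, Prod.mk.eta, hp]
      rw [partialOne_eq_dOne h5.differentiableAt, partialTwo_eq_dTwo h5.differentiableAt]
    rw [hZH, hZK, hAv] at h1'
    have e1 := (Prod.ext_iff.1 (Prod.ext_iff.1 h1').1).1
    have e2 := (Prod.ext_iff.1 (Prod.ext_iff.1 h1').1).2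
    simp only at e1 e2
    obtain ⟨f1, f2⟩ := dOne_dTwo_comp h4.differentiableAt h3.differentiableAt
    rw [f1, f2]
    constructor
    · linear_combination dOne (fun p => (Φ p).2) p * e1 - dOne (fun p => (Φ p).1) p * e2 + dOne K p * h2
    · linear_combination dTwo (fun p => (Φ p).2) p * e1 - dTwo (fun p => (Φ p).1) p * e2 + dTwo K p * h2
  obtain ⟨c, hc⟩ := exists_eq_add_of_dOne_dTwo_eq (hΦ.analyticAt_comp hH) hK hd
  refine ⟨hΦ.comp hG.symplectic, hG.analytic, c, ?_⟩
  filter_upwards [hG.symplectic.tendsto.eventually hc, hG.normal_form] with p e1 e2 hp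
  rw [e1 hp, e2]
  rfl

/-! ### The Morse lemma with parameters. -/

/-- Hadamard's lemma in the fibre coordinates. -/
theorem exists_linear_split {f : PhaseSpace → ℂ} (hf : AnalyticAt ℂ f 0) :
    ∃ A B : PhaseSpace → ℂ, AnalyticAt ℂ A 0 ∧ AnalyticAt ℂ B 0 ∧
      ∀ᶠ p in 𝓝 (0 : PhaseSpace), f p = f (0, p.2) + (p.1.1 * A p + p.1.2 * B p) := by
  let ℓ₁ : PhaseSpace →L[ℂ] ℂ :=
    (ContinuousLinearMap.fst ℂ ℂ ℂ).comp (ContinuousLinearMap.fst ℂ Plane (ℂ × ℂ))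
  let ℓ₂ : PhaseSpace →L[ℂ] ℂ :=
    (ContinuousLinearMap.snd ℂ ℂ ℂ).comp (ContinuousLinearMap.fst ℂ Plane (ℂ × ℂ))
  obtain ⟨A, hA, h₁⟩ := hf.exists_sub_eq_mul ℓ₁ (((1, 0), 0) : PhaseSpace)
  obtain ⟨B, hB, h₂⟩ := hf.exists_sub_eq_mul ℓ₂ (((0, 1), 0) : PhaseSpace)
  have hi : AnalyticAt ℂ (fun p : PhaseSpace => (((0, p.1.2), p.2) : PhaseSpace)) 0 :=
    (analyticAt_const.prod (analyticAt_coord_two 0)).prod analyticAt_snd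
  have ht : Tendsto (fun p : PhaseSpace => (((0, p.1.2), p.2) : PhaseSpace)) (𝓝 0) (𝓝 0) :=
    Continuous.tendsto' (by fun_prop) _ _ rfl
  refine ⟨A, fun p => B ((0, p.1.2), p.2), hA, hB.fun_comp_of_eq hi rfl, ?_⟩
  filter_upwards [h₁, ht.eventually h₂] with p e₁ e₂
  have z₁ : p - ℓ₁ p • (((1, 0), 0) : PhaseSpace) = ((0, p.1.2), p.2) := by
    ext <;> simp [ℓ₁]
  have z₂ : (((0, p.1.2), p.2) : PhaseSpace) - ℓ₂ ((0, p.1.2), p.2) • (((0, 1), 0) : PhaseSpace)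
      = (0, p.2) := by
    ext <;> simp [ℓ₂]
  rw [z₁, show ℓ₁ p = p.1.1 from rfl] at e₁
  rw [z₂, show ℓ₂ ((0, p.1.2), p.2) = p.1.2 from rfl] at e₂
  linear_combination e₁ + e₂

theorem tendsto_zero_fiber : Tendsto (fun p : PhaseSpace => (((0 : Plane), p.2) : PhaseSpace))
    (𝓝 0) (𝓝 0) := Continuous.tendsto' (by fun_prop) _ _ rfl

theorem linear_split_deriv {f A B : PhaseSpace → ℂ} (hf : AnalyticAt ℂ f 0)
    (hA : AnalyticAt ℂ A 0) (hB : AnalyticAt ℂ B 0)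
    (h : ∀ᶠ p in 𝓝 (0 : PhaseSpace), f p = f (0, p.2) + (p.1.1 * A p + p.1.2 * B p)) :
    ∀ᶠ p in 𝓝 (0 : PhaseSpace),
      dOne f p = A p + p.1.1 * dOne A p + p.1.2 * dOne B p ∧
      dTwo f p = B p + p.1.1 * dTwo A p + p.1.2 * dTwo B p := by
  have hl : AnalyticAt ℂ (fun p : PhaseSpace => p.1.1 * A p + p.1.2 * B p) 0 :=
    ((analyticAt_coord_one 0).mul hA).add ((analyticAt_coord_two 0).mul hB)
  filter_upwards [eventually_dOne_dTwo_eq (S := Set.univ) (c := fun q => f (0, q)) hf hl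
    (h.mono fun p hp _ => by rw [hp, add_comm]), hA.eventually_analyticAt,
    hB.eventually_analyticAt] with p e a b
  obtain ⟨e₁, e₂⟩ := e trivial
  obtain ⟨l₁, l₂⟩ := dOne_dTwo_linear a.differentiableAt b.differentiableAt
  exact ⟨e₁.trans l₁, e₂.trans l₂⟩

/-- A Hamiltonian that is critical along the zero section is a quadratic form with analytic
coefficients, up to a function of the parameters. -/
theorem exists_quadratic_form {H : PhaseSpace → ℂ} (hH : AnalyticAt ℂ H 0)
    (hc : ∀ᶠ p in 𝓝 (0 : PhaseSpace), dOne H (0, p.2) = 0 ∧ dTwo H (0, p.2) = 0) :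
    ∃ a b c : PhaseSpace → ℂ, AnalyticAt ℂ a 0 ∧ AnalyticAt ℂ b 0 ∧ AnalyticAt ℂ c 0 ∧
      (hessian H 0).det = 4 * (a 0 * c 0 - b 0 ^ 2) ∧
      ∀ᶠ p in 𝓝 (0 : PhaseSpace),
        H p = H (0, p.2) + (a p * p.1.1 ^ 2 + 2 * b p * p.1.1 * p.1.2 + c p * p.1.2 ^ 2) := by
  obtain ⟨A, B, hA, hB, h⟩ := exists_linear_split hH
  obtain ⟨A₁, A₂, hA₁, hA₂, hAs⟩ := exists_linear_split hA
  obtain ⟨B₁, B₂, hB₁, hB₂, hBs⟩ := exists_linear_split hB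
  have hd := linear_split_deriv hH hA hB h
  have dA := (linear_split_deriv hA hA₁ hA₂ hAs).self_of_nhds
  have dB := (linear_split_deriv hB hB₁ hB₂ hBs).self_of_nhds
  simp only [Prod.fst_zero, Prod.snd_zero, zero_mul, add_zero] at dA dB
  -- On the zero section A and B are the fibre derivatives of H, which vanish there, so their second
  -- splitting has no constant term.
  have hAB : ∀ᶠ p in 𝓝 (0 : PhaseSpace),
      A p = p.1.1 * A₁ p + p.1.2 * A₂ p ∧ B p = p.1.1 * B₁ p + p.1.2 * B₂ p := by
    filter_upwards [hAs, hBs, hc, tendsto_zero_fiber.eventually hd] with p e₁ e₂ e₃ e₄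
    simp only [Prod.fst_zero, Prod.snd_zero, zero_mul, add_zero, e₃] at e₄
    rw [e₁, e₂, ← e₄.1, ← e₄.2]
    simp
  refine ⟨A₁, fun p => (A₂ p + B₁ p) / 2, B₂, hA₁, (hA₂.add hB₁).div_const, hB₂, ?_, ?_⟩
  · have e₁ : dOne H =ᶠ[𝓝 0] fun p => 1 * (p.1.1 * (A₁ + dOne A) p + p.1.2 * (A₂ + dOne B) p) := by
      filter_upwards [hd, hAB] with p e₁ e₂
      rw [e₁.1, e₂.1]
      simp only [Pi.add_apply]
      ring
    have e₂ : dTwo H =ᶠ[𝓝 0] fun p => 1 * (p.1.1 * (B₁ + dTwo A) p + p.1.2 * (B₂ + dTwo B) p) := by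
      filter_upwards [hd, hAB] with p e₁ e₂
      rw [e₁.2, e₂.2]
      simp only [Pi.add_apply]
      ring
    have l₁ := dOne_dTwo_mul_linear (g := fun _ => 1) analyticAt_const (hA₁.add hA.dOne)
      (hA₂.add hB.dOne)
    have l₂ := dOne_dTwo_mul_linear (g := fun _ => 1) analyticAt_const (hB₁.add hA.dTwo)
      (hB₂.add hB.dTwo)
    rw [hessian_det_eq hH]
    have f₁ : dOne (dOne H) 0 = 1 * (A₁ + dOne A) 0 := by rw [dOne, e₁.fderiv_eq]; exact l₁.1
    have f₂ : dTwo (dOne H) 0 = 1 * (A₂ + dOne B) 0 := by rw [dTwo, e₁.fderiv_eq]; exact l₁.2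
    have f₃ : dOne (dTwo H) 0 = 1 * (B₁ + dTwo A) 0 := by rw [dOne, e₂.fderiv_eq]; exact l₂.1
    have f₄ : dTwo (dTwo H) 0 = 1 * (B₂ + dTwo B) 0 := by rw [dTwo, e₂.fderiv_eq]; exact l₂.2
    rw [f₁, f₂, f₃, f₄]
    simp only [Pi.add_apply, dA.1, dA.2, dB.1, dB.2]
    ring
  · filter_upwards [h, hAB] with p e₁ e₂
    rw [e₁, e₂.1, e₂.2]
    ring

/-- The Morse lemma with parameters. -/
theorem exists_morse {H : PhaseSpace → ℂ} (hH : AnalyticAt ℂ H 0)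
    (hn : (hessian H 0).det ≠ 0)
    (hc : ∀ᶠ p in 𝓝 (0 : PhaseSpace), dOne H (0, p.2) = 0 ∧ dTwo H (0, p.2) = 0) :
    ∃ φ : PhaseSpace → Plane, AnalyticAt ℂ φ 0 ∧ φ 0 = 0 ∧ jac φ 0 ≠ 0 ∧
      ∀ᶠ p in 𝓝 (0 : PhaseSpace), H (φ p, p.2) = H (0, p.2) + prodUV p := by
  obtain ⟨a, b, c, ha, hb, hc', hdet, hq⟩ := exists_quadratic_form hH hc
  have hD0 : b 0 ^ 2 - a 0 * c 0 ≠ 0 := by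
    intro h
    exact hn (by rw [hdet]; linear_combination -4 * h)
  -- The root is chosen so that b + d₀ ≠ 0: both signs can fail only if d₀ = 0, which nondegeneracy
  -- excludes.
  obtain ⟨d₀, hd₀, hbd⟩ : ∃ d₀ : ℂ, d₀ ^ 2 = b 0 ^ 2 - a 0 * c 0 ∧ b 0 + d₀ ≠ 0 := by
    obtain ⟨d, hd⟩ := IsAlgClosed.exists_pow_nat_eq (b 0 ^ 2 - a 0 * c 0) (n := 2) (by norm_num)
    by_cases h : b 0 + d = 0
    · refine ⟨-d, by rw [← hd]; ring, fun h' => hD0 ?_⟩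
      have : d = 0 := by linear_combination (h - h') / 2
      rw [← hd, this]; ring
    · exact ⟨d, hd, h⟩
  have hd₀ne : d₀ ≠ 0 := by rintro rfl; exact hD0 (by rw [← hd₀]; ring)
  obtain ⟨d, hd, hd0, hdsq⟩ := ((hb.pow 2).sub (ha.mul hc')).exists_sq_eq hd₀ hd₀ne
  set δ : PhaseSpace → ℂ := fun p => b p + d p with hδ
  have aδ : AnalyticAt ℂ δ 0 := hb.add hd
  have hδ0 : δ 0 ≠ 0 := by simp only [hδ, hd0]; exact hbd
  have aγ : AnalyticAt ℂ (fun p => c p / δ p) 0 := hc'.div aδ hδ0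
  have ao : AnalyticAt ℂ (fun _ : PhaseSpace => (1 : ℂ)) 0 := analyticAt_const
  -- Factorization of the quadratic form into (u₁ + (c/δ)u₂)(a u₁ + δ u₂) with δ = b + d; the cross
  -- term is right because ac/δ = b - d. The Jacobian at 0 is 2d₀. The factors 1 match
  -- `dOne_dTwo_mul_linear`.
  let M : PhaseSpace → Plane := fun p =>
    (1 * (p.1.1 * 1 + p.1.2 * (c p / δ p)), 1 * (p.1.1 * a p + p.1.2 * δ p))
  have aM : AnalyticAt ℂ M 0 :=
    (ao.mul (((analyticAt_coord_one 0).mul ao).add ((analyticAt_coord_two 0).mul aγ))).prod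
      (ao.mul (((analyticAt_coord_one 0).mul ha).add ((analyticAt_coord_two 0).mul aδ)))
  have hM0 : M 0 = 0 := by simp [M]
  have hjM : jac M 0 ≠ 0 := by
    obtain ⟨l₁, l₂⟩ := dOne_dTwo_mul_linear ao ao aγ
    obtain ⟨l₃, l₄⟩ := dOne_dTwo_mul_linear ao ha aδ
    rw [jac_eq aM.differentiableAt, l₁, l₂, l₃, l₄]
    have : δ 0 = b 0 + d₀ := by simp only [hδ, hd0]
    have h2 : (δ 0) * (1 * 1 * (1 * δ 0) - 1 * (c 0 / δ 0) * (1 * a 0)) = 2 * δ 0 * d₀ := by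
      field_simp
      rw [this]
      linear_combination -hd₀
    exact right_ne_zero_of_mul (a := δ 0) (by rw [h2]; exact mul_ne_zero (mul_ne_zero two_ne_zero hδ0) hd₀ne)
  obtain ⟨φ, aφ, hφ0, hr, -⟩ := exists_fibered_inverse_of_jac aM hM0 hjM
  refine ⟨φ, aφ, hφ0, ?_, ?_⟩
  · have := (jac_mul_jac_of_inverse aM aφ hφ0 hr).self_of_nhds
    exact right_ne_zero_of_mul (by rw [this]; exact one_ne_zero)
  · have ht := tendsto_fibered aφ hφ0
    filter_upwards [hr, ht.eventually hq, ht.eventually hdsq,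
      ht.eventually (aδ.continuousAt.eventually_ne hδ0)] with p e₁ e₂ e₃ e₄
    rw [e₂]
    have h₁ := (Prod.ext_iff.1 e₁).1
    have h₂ := (Prod.ext_iff.1 e₁).2
    simp only [M] at h₁ h₂
    simp only [Pi.sub_apply, Pi.pow_apply, Pi.mul_apply] at e₃
    rw [prodUV, ← h₁, ← h₂]
    simp only [hδ] at e₄ ⊢
    field_simp
    linear_combination (-(φ p).1 * (φ p).2) * e₃

/-! ### Averaging over the circle and maps of prescribed Jacobian. -/

theorem continuous_clm_prod {X E F F' : Type*} [TopologicalSpace X] [NormedAddCommGroup E]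
    [NormedSpace ℂ E] [NormedAddCommGroup F] [NormedSpace ℂ F] [NormedAddCommGroup F']
    [NormedSpace ℂ F'] {A : X → E →L[ℂ] F} {B : X → E →L[ℂ] F'} (hA : Continuous A)
    (hB : Continuous B) : Continuous fun x => (A x).prod (B x) :=
  (ContinuousLinearMap.prodₗᵢ (𝕜 := ℂ) ℂ).continuous.comp (hA.prodMk hB)

theorem continuous_flow_mul_I : Continuous fun θ : ℝ => flow (θ * Complex.I) :=
  continuous_clm_prod (continuous_clm_prod (by fun_prop) (by fun_prop)) continuous_const

theorem euler_eq_of_hasDerivAt {f : PhaseSpace → ℂ} {p : PhaseSpace} (hf : DifferentiableAt ℂ f p)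
    {c : ℂ} (h : HasDerivAt (fun θ : ℝ => f (flow (θ * Complex.I) p)) (Complex.I * c) 0) :
    euler f p = c := by
  have h1 := hasDerivAt_flow_mul_I (f := f) (θ := 0) (p := p) (by simpa using hf)
  have h2 := h1.unique h
  simp only [Complex.ofReal_zero, zero_mul, flow_zero] at h2
  exact mul_left_cancel₀ Complex.I_ne_zero h2

/-- Averaging over the circle action solves `J = a + euler b` with `a` an invariant function. -/
theorem exists_average {J : PhaseSpace → ℂ} (hJ : AnalyticAt ℂ J 0) :
    ∃ a b : PhaseSpace → ℂ, AnalyticAt ℂ a 0 ∧ AnalyticAt ℂ b 0 ∧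
      (∀ᶠ p in 𝓝 (0 : PhaseSpace), euler a p = 0) ∧
      ∀ᶠ p in 𝓝 (0 : PhaseSpace), J p = a p + euler b p := by
  set τ : ℝ := 2 * Real.pi with hτ
  have hτ0 : (τ : ℂ) ≠ 0 := by
    rw [hτ]; exact_mod_cast (mul_pos two_pos Real.pi_pos).ne'
  let a : PhaseSpace → ℂ := fun p => ∫ θ in (0 : ℝ)..τ, (1 / τ : ℂ) * J (flow (θ * Complex.I) p)
  -- The linear weight inverts E on functions of mean zero: integrating by parts over one period
  -- leaves the boundary term J minus its average.
  let b : PhaseSpace → ℂ := fun p =>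
    ∫ θ in (0 : ℝ)..τ, (Complex.I / τ * θ : ℂ) * J (flow (θ * Complex.I) p)
  have ha : AnalyticAt ℂ a 0 := analyticAt_intervalIntegral_comp_clm hJ continuous_flow_mul_I
    (w := fun _ => (1 / τ : ℂ)) continuous_const 0 τ
  have hb : AnalyticAt ℂ b 0 := analyticAt_intervalIntegral_comp_clm hJ continuous_flow_mul_I
    (w := fun θ => (Complex.I / τ * θ : ℂ)) (by fun_prop) 0 τ
  obtain ⟨δ, hδ, hball⟩ := Metric.eventually_nhds_iff_ball.1 hJ.eventually_analyticAt
  have key : ∀ p : PhaseSpace, ‖p‖ < δ → DifferentiableAt ℂ a p → DifferentiableAt ℂ b p →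
      euler a p = 0 ∧ J p = a p + euler b p := by
    intro p hp dap dbp
    let j : ℝ → ℂ := fun θ => J (flow (θ * Complex.I) p)
    have hj : Continuous j := by
      rw [continuous_iff_continuousAt]
      intro θ
      have h1 : AnalyticAt ℂ J (flow (θ * Complex.I) p) :=
        hball _ (by rwa [mem_ball_zero_iff, norm_flow])
      have h2 : Continuous fun θ : ℝ => flow (θ * Complex.I) p :=
        continuous_flow_mul_I.clm_apply continuous_const
      exact ContinuousAt.comp (f := fun θ : ℝ => flow (θ * Complex.I) p) h1.continuousAt
        h2.continuousAt
    have hper : Function.Periodic j τ := by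
      intro θ
      simp only [j]
      rw [show ((θ + τ : ℝ) : ℂ) * Complex.I = θ * Complex.I + 2 * Real.pi * Complex.I by
        rw [hτ]; push_cast; ring, flow_add, flow_two_pi]
    have hshift : ∀ φ θ : ℝ, J (flow (θ * Complex.I) (flow (φ * Complex.I) p)) = j (θ + φ) := by
      intro φ θ
      simp only [j]
      rw [← flow_add]
      congr 3
      push_cast
      ring
    have hint : ∀ φ : ℝ, ∫ θ in φ..(φ + τ), j θ = ∫ θ in (0 : ℝ)..τ, j θ := fun φ => by
      simpa using hper.intervalIntegral_add_eq φ 0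
    have haφ : ∀ φ : ℝ, a (flow (φ * Complex.I) p) = (1 / τ) * ∫ θ in (0 : ℝ)..τ, j θ := by
      intro φ
      simp only [a, hshift]
      rw [intervalIntegral.integral_const_mul, intervalIntegral.integral_comp_add_right, zero_add,
        add_comm τ φ, hint]
    have hap : a p = (1 / τ) * ∫ θ in (0 : ℝ)..τ, j θ := by simpa using haφ 0
    have hprim : ∀ φ : ℝ, HasDerivAt (fun φ : ℝ => ∫ θ in (0 : ℝ)..φ, (θ : ℂ) * j θ) (φ * j φ) φ :=
      fun φ => (Continuous.mul (by fun_prop) hj).integral_hasStrictDerivAt 0 φ |>.hasDerivAt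
    -- The shift by φ is moved from the integrand to the limits, so differentiating in φ needs only
    -- the fundamental theorem of calculus.
    have hbφ : ∀ φ : ℝ, b (flow (φ * Complex.I) p) = Complex.I / τ *
        (((∫ θ in (0 : ℝ)..(φ + τ), (θ : ℂ) * j θ) - ∫ θ in (0 : ℝ)..φ, (θ : ℂ) * j θ)
          - φ * ∫ θ in (0 : ℝ)..τ, j θ) := by
      intro φ
      simp only [b, hshift]
      have e : ∀ θ : ℝ, (Complex.I / τ * θ : ℂ) * j (θ + φ) =
          Complex.I / τ * ((fun t : ℝ => ((t : ℂ) - φ) * j t) (θ + φ)) := by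
        intro θ; push_cast; ring
      simp only [e]
      rw [intervalIntegral.integral_const_mul,
        intervalIntegral.integral_comp_add_right (fun t : ℝ => ((t : ℂ) - φ) * j t), zero_add,
        add_comm τ φ]
      have c₁ : Continuous fun t : ℝ => (t : ℂ) * j t := Continuous.mul (by fun_prop) hj
      have c₂ : Continuous fun t : ℝ => (φ : ℂ) * j t := continuous_const.mul hj
      simp only [sub_mul]
      rw [intervalIntegral.integral_sub (c₁.intervalIntegrable _ _) (c₂.intervalIntegrable _ _),
        intervalIntegral.integral_const_mul, hint,
        intervalIntegral.integral_interval_sub_left (c₁.intervalIntegrable _ _)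
          (c₁.intervalIntegrable _ _)]
    constructor
    · refine euler_eq_of_hasDerivAt dap ?_
      simp only [haφ, mul_zero]
      exact hasDerivAt_const _ _
    · have hE : euler b p = J p - a p := by
        refine euler_eq_of_hasDerivAt dbp ?_
        simp only [hbφ]
        have h1 : HasDerivAt (fun φ : ℝ => ∫ θ in (0 : ℝ)..(φ + τ), (θ : ℂ) * j θ)
            (((0 + τ : ℝ) : ℂ) * j (0 + τ)) 0 := (hprim (0 + τ)).comp_add_const 0 τ
        have h2 : HasDerivAt (fun φ : ℝ => (φ : ℂ) * ∫ θ in (0 : ℝ)..τ, j θ)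
            (1 * ∫ θ in (0 : ℝ)..τ, j θ) 0 :=
          (Complex.ofRealCLM.hasDerivAt (x := 0)).mul_const _
        refine (((h1.sub (hprim 0)).sub h2).const_mul (Complex.I / τ)).congr_deriv ?_
        have hj0 : j (0 + τ) = J p := by rw [hper 0]; simp [j]
        rw [hj0, hap]
        simp only [zero_add, Complex.ofReal_zero]
        field_simp
        ring
      rw [hE]; ring
  have hev : ∀ᶠ p in 𝓝 (0 : PhaseSpace), euler a p = 0 ∧ J p = a p + euler b p := by
    filter_upwards [Metric.ball_mem_nhds (0 : PhaseSpace) hδ, ha.eventually_analyticAt,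
      hb.eventually_analyticAt] with p h1 h2 h3
    exact key p (mem_ball_zero_iff.1 h1) h2.differentiableAt h3.differentiableAt
  exact ⟨a, b, ha, hb, hev.mono fun _ h => h.1, hev.mono fun _ h => h.2⟩

/-- An invariant germ is an analytic function of `h = u₁ u₂`. -/
theorem exists_eq_comp_prodUV {a : PhaseSpace → ℂ} (ha : AnalyticAt ℂ a 0)
    (hE : ∀ᶠ p in 𝓝 (0 : PhaseSpace), euler a p = 0) :
    ∃ α : Base → ℂ, AnalyticAt ℂ α 0 ∧ ∀ᶠ p in 𝓝 (0 : PhaseSpace), a p = α (prodUV p, p.2) := by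
  obtain ⟨δ, hδ, hball⟩ := Metric.eventually_nhds_iff_ball.1 (hE.and ha.eventually_analyticAt)
  simp only [mem_ball_zero_iff] at hball
  have hη : (0 : ℝ) < δ / 2 := by positivity
  set η : ℂ := ((δ / 2 : ℝ) : ℂ) with hηdef
  have hηne : η ≠ 0 := by rw [hηdef]; exact_mod_cast hη.ne'
  have hηnorm : ‖η‖ = δ / 2 := by
    rw [hηdef, Complex.norm_real, Real.norm_eq_abs, abs_of_pos hη]
  -- A section of u₁u₂ on the line u₁ = η; α is the restriction of a to it.
  let ι : Base → PhaseSpace := fun q => ((η, q.1 / η), q.2)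
  have hι : AnalyticAt ℂ ι 0 := (analyticAt_const.prod (analyticAt_fst.div_const)).prod analyticAt_snd
  have hι0 : ‖ι 0‖ < δ := by
    have : ‖ι 0‖ = ‖η‖ := by simp [ι, Prod.norm_def]
    rw [this, hηnorm]; linarith
  have hα : AnalyticAt ℂ (fun q => a (ι q)) 0 := (hball _ hι0).2.fun_comp hι
  refine ⟨fun q => a (ι q), hα, ?_⟩
  have hαh : AnalyticAt ℂ (fun p : PhaseSpace => a (ι (prodUV p, p.2))) 0 :=
    analyticAt_fibered_comp (analyticAt_prodUV 0) (by simp [prodUV]) hα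
  have hzero := (ha.sub hαh).eventually_eq_zero_of_ne
    (ℓ := (ContinuousLinearMap.fst ℂ ℂ ℂ).comp (ContinuousLinearMap.fst ℂ Plane (ℂ × ℂ)))
    (v := ((1, 0), 0)) rfl ?_
  · exact hzero.mono fun p hp => sub_eq_zero.1 hp
  · filter_upwards [Metric.ball_mem_nhds (0 : PhaseSpace) hη] with p hp hne
    have hne : p.1.1 ≠ 0 := hne
    rw [mem_ball_zero_iff] at hp
    have hu₁ : ‖p.1.1‖ < δ / 2 := ((norm_fst_le p.1).trans (norm_fst_le p)).trans_lt hp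
    have hu₂ : ‖p.1.2‖ < δ / 2 := ((norm_snd_le p.1).trans (norm_fst_le p)).trans_lt hp
    have hq : ‖p.2‖ < δ / 2 := (norm_snd_le p).trans_lt hp
    -- The complex time carrying u₁ to η. As |u₁| < |η|, its real part is nonnegative: u₁ grows to
    -- size δ/2 at most and u₂ does not grow, so the path stays in the ball.
    set s₀ : ℂ := Complex.log (η / p.1.1) with hs₀
    have hexp : Complex.exp s₀ = η / p.1.1 := Complex.exp_log (div_ne_zero hηne hne)
    have hre : 0 ≤ s₀.re := by
      rw [hs₀, Complex.log_re]
      refine Real.log_nonneg ?_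
      rw [norm_div, hηnorm, one_le_div (norm_pos_iff.2 hne)]
      exact hu₁.le
    have hnexp : Real.exp s₀.re * ‖p.1.1‖ = δ / 2 := by
      rw [← Complex.norm_exp, hexp, norm_div, hηnorm]
      field_simp [norm_ne_zero_iff.2 hne]
    have hmem : ∀ t ∈ Set.Icc (0 : ℝ) 1, ‖flow (t * s₀) p‖ < δ := by
      intro t ht
      have r₁ : (t * s₀ : ℂ).re ≤ s₀.re := by
        rw [Complex.re_ofReal_mul]; exact mul_le_of_le_one_left hre ht.2
      have r₂ : (-(t * s₀) : ℂ).re ≤ 0 := by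
        rw [Complex.neg_re, Complex.re_ofReal_mul]; exact neg_nonpos.2 (mul_nonneg ht.1 hre)
      rw [flow_apply]
      refine max_lt (max_lt ?_ ?_) (hq.trans (by linarith))
      · rw [norm_mul, Complex.norm_exp]
        calc _ ≤ Real.exp s₀.re * ‖p.1.1‖ := by gcongr
          _ < δ := by rw [hnexp]; linarith
      · rw [norm_mul, Complex.norm_exp]
        calc _ ≤ 1 * ‖p.1.2‖ := by gcongr; exact Real.exp_le_one_iff.2 r₂
          _ < δ := by linarith
    have hder : ∀ t ∈ Set.Icc (0 : ℝ) 1, HasDerivAt (fun t : ℝ => a (flow (t * s₀) p)) 0 t := by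
      intro t ht
      obtain ⟨h1, h2⟩ := hball _ (hmem t ht)
      have h3 : HasDerivAt (fun t : ℝ => (t * s₀ : ℂ)) s₀ t := by
        simpa using (Complex.ofRealCLM.hasDerivAt (x := t)).mul_const s₀
      refine (HasDerivAt.comp (h := fun t : ℝ => (t * s₀ : ℂ)) t
        (hasDerivAt_flow h2.differentiableAt) h3).congr_deriv ?_
      rw [h1, zero_mul]
    have hconst := constant_of_has_deriv_right_zero
      (fun t ht => (hder t ht).continuousAt.continuousWithinAt)
      (fun t ht => (hder t ⟨ht.1, ht.2.le⟩).hasDerivWithinAt) 1 (by simp)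
    simp only [Complex.ofReal_one, one_mul, Complex.ofReal_zero, zero_mul, flow_zero] at hconst
    have hend : flow s₀ p = ι (prodUV p, p.2) := by
      simp only [flow_apply, ι, prodUV, Complex.exp_neg, hexp]
      ext
      · simp [hne]
      · simp; field_simp
      · rfl
      · rfl
    rw [hend] at hconst
    exact sub_eq_zero.2 hconst.symm

/-- Every germ `α(h, x, ε)` has a primitive in `h` of the form `h m(h, x, ε)`. -/
theorem exists_primitive {α : Base → ℂ} (hα : AnalyticAt ℂ α 0) :
    ∃ m : Base → ℂ, AnalyticAt ℂ m 0 ∧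
      ∀ᶠ q in 𝓝 (0 : Base), m q + q.1 * partialH m q = α q := by
  let T : ℝ → Base →L[ℂ] Base := fun t =>
    ((t : ℂ) • ContinuousLinearMap.fst ℂ ℂ (ℂ × ℂ)).prod (ContinuousLinearMap.snd ℂ ℂ (ℂ × ℂ))
  have hT : Continuous T := continuous_clm_prod (by fun_prop) continuous_const
  have hTapp : ∀ t q, T t q = (t * q.1, q.2) := fun t q => rfl
  have hm := analyticAt_intervalIntegral_comp_clm hα hT (w := fun _ => 1) continuous_const 0 1
  set m : Base → ℂ := fun q => ∫ t in (0 : ℝ)..1, (1 : ℂ) * α (T t q) with hmdef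
  refine ⟨m, hm, ?_⟩
  obtain ⟨δ, hδ, hball⟩ := Metric.eventually_nhds_iff_ball.1 hα.eventually_analyticAt
  filter_upwards [Metric.ball_mem_nhds (0 : Base) hδ, hm.eventually_analyticAt] with q hq hmq
  rw [mem_ball_zero_iff] at hq
  have hq1 : q.1 ∈ Metric.ball (0 : ℂ) δ := mem_ball_zero_iff.2 ((norm_fst_le q).trans_lt hq)
  have hq2 : ‖q.2‖ < δ := (norm_snd_le q).trans_lt hq
  have han : ∀ z ∈ Metric.ball (0 : ℂ) δ, AnalyticAt ℂ α (z, q.2) := fun z hz =>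
    hball _ (mem_ball_zero_iff.2 (max_lt (mem_ball_zero_iff.1 hz) hq2))
  have hdz : ∀ z ∈ Metric.ball (0 : ℂ) δ, DifferentiableAt ℂ (fun z => α (z, q.2)) z := fun z hz =>
    DifferentiableAt.comp (f := fun z : ℂ => ((z, q.2) : Base)) z (han z hz).differentiableAt
      (by fun_prop)
  obtain ⟨F, hF⟩ := DifferentiableOn.isExactOn_ball (f := fun z => α (z, q.2)) (c := 0) (r := δ)
    fun z hz => (hdz z hz).differentiableWithinAt
  -- With m the integral of α(th) over [0, 1], h m is the primitive of α vanishing at h = 0; its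
  -- derivative is read off without differentiating under the integral.
  have hzm : ∀ z ∈ Metric.ball (0 : ℂ) δ, z * m (z, q.2) = F z - F 0 := by
    intro z hz
    have hmem : ∀ t ∈ Set.uIcc (0 : ℝ) 1, (t * z : ℂ) ∈ Metric.ball (0 : ℂ) δ := by
      intro t ht
      rw [Set.uIcc_of_le zero_le_one] at ht
      rw [mem_ball_zero_iff] at hz ⊢
      rw [norm_mul, Complex.norm_real, Real.norm_eq_abs, abs_of_nonneg ht.1]
      exact (mul_le_of_le_one_left (norm_nonneg _) ht.2).trans_lt hz
    have hder : ∀ t ∈ Set.uIcc (0 : ℝ) 1,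
        HasDerivAt (fun t : ℝ => F (t * z)) (α (t * z, q.2) * z) t := by
      intro t ht
      have h3 : HasDerivAt (fun t : ℝ => (t * z : ℂ)) z t := by
        simpa using (Complex.ofRealCLM.hasDerivAt (x := t)).mul_const z
      exact HasDerivAt.comp (h := fun t : ℝ => (t * z : ℂ)) t (hF _ (hmem t ht)) h3
    have hcont : ContinuousOn (fun t : ℝ => α (t * z, q.2) * z) (Set.uIcc 0 1) := by
      intro t ht
      have h4 : ContinuousAt (fun t : ℝ => (t * z : ℂ)) t := by fun_prop
      exact ((ContinuousAt.comp (f := fun t : ℝ => (t * z : ℂ)) (hdz _ (hmem t ht)).continuousAt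
        h4).mul continuousAt_const).continuousWithinAt
    have := intervalIntegral.integral_eq_sub_of_hasDerivAt hder hcont.intervalIntegrable
    rw [intervalIntegral.integral_mul_const] at this
    simp only [Complex.ofReal_one, one_mul, Complex.ofReal_zero, zero_mul] at this
    rw [← this, mul_comm]
    simp only [hmdef, hTapp, one_mul]
  have h1 : HasDerivAt (fun z => F z - F 0) (α q) q.1 := (hF _ hq1).sub_const _
  have h2 : HasDerivAt (fun z => z * m (z, q.2)) (1 * m q + q.1 * partialH m q) q.1 := by
    have h3 : DifferentiableAt ℂ (fun z => m (z, q.2)) q.1 :=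
      DifferentiableAt.comp (f := fun z : ℂ => ((z, q.2) : Base)) q.1 hmq.differentiableAt
        (by fun_prop)
    exact (hasDerivAt_id q.1).mul h3.hasDerivAt
  have h3 : (fun z => z * m (z, q.2)) =ᶠ[𝓝 q.1] fun z => F z - F 0 := by
    filter_upwards [Metric.isOpen_ball.mem_nhds hq1] with z hz
    exact hzm z hz
  have := h2.unique (h1.congr_of_eventuallyEq h3)
  rwa [one_mul] at this

theorem dOne_dTwo_cexp {f : PhaseSpace → ℂ} {p : PhaseSpace} (hf : DifferentiableAt ℂ f p) :
    dOne (fun p => Complex.exp (f p)) p = Complex.exp (f p) * dOne f p ∧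
    dTwo (fun p => Complex.exp (f p)) p = Complex.exp (f p) * dTwo f p := by
  have h := hf.hasFDerivAt.cexp.fderiv
  constructor
  · rw [dOne, h]; rfl
  · rw [dTwo, h]; rfl

theorem dOne_dTwo_neg (f : PhaseSpace → ℂ) (p : PhaseSpace) :
    dOne (fun p => -f p) p = -dOne f p ∧ dTwo (fun p => -f p) p = -dTwo f p := by
  have h : fderiv ℂ (fun p => -f p) p = -fderiv ℂ f p := fderiv_neg
  constructor
  · rw [dOne, h]; rfl
  · rw [dTwo, h]; rfl

/-- The Jacobian determinant of `(u₁, u₂) ↦ (u₁ s(h) e^β, u₂ s(h) e^{-β})`. -/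
theorem jac_scale_twist {s : Base → ℂ} {β : PhaseSpace → ℂ} {p : PhaseSpace}
    (hs : AnalyticAt ℂ s (prodUV p, p.2)) (hβ : AnalyticAt ℂ β p) :
    jac (fun p => (p.1.1 * (s (prodUV p, p.2) * Complex.exp (β p)),
        p.1.2 * (s (prodUV p, p.2) * Complex.exp (-β p)))) p =
      (s (prodUV p, p.2) ^ 2 +
        2 * prodUV p * s (prodUV p, p.2) * partialH s (prodUV p, p.2)) * (1 + euler β p) := by
  have aS : AnalyticAt ℂ (fun p : PhaseSpace => s (prodUV p, p.2)) p :=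
    AnalyticAt.fun_comp (f := fun p : PhaseSpace => (prodUV p, p.2)) hs
      ((analyticAt_prodUV p).prod analyticAt_snd)
  have dS := aS.differentiableAt
  have dX : DifferentiableAt ℂ (fun p => Complex.exp (β p)) p := hβ.differentiableAt.cexp
  have dY : DifferentiableAt ℂ (fun p => Complex.exp (-β p)) p := hβ.differentiableAt.neg.cexp
  have du := (analyticAt_coord_one p).differentiableAt
  have dv := (analyticAt_coord_two p).differentiableAt
  rw [jac_eq ((du.fun_mul (dS.fun_mul dX)).prodMk (dv.fun_mul (dS.fun_mul dY)))]
  obtain ⟨m₁, m₂⟩ := dOne_dTwo_mul (g := fun p => s (prodUV p, p.2) * Complex.exp (β p))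
    du (dS.mul dX)
  obtain ⟨m₃, m₄⟩ := dOne_dTwo_mul (g := fun p => s (prodUV p, p.2) * Complex.exp (-β p))
    dv (dS.mul dY)
  obtain ⟨n₁, n₂⟩ := dOne_dTwo_mul dS dX
  obtain ⟨n₃, n₄⟩ := dOne_dTwo_mul dS dY
  obtain ⟨x₁, x₂⟩ := dOne_dTwo_cexp hβ.differentiableAt
  obtain ⟨y₁, y₂⟩ := dOne_dTwo_cexp (f := fun p => -β p) hβ.differentiableAt.neg
  obtain ⟨k₁, k₂⟩ := dOne_dTwo_neg β p
  obtain ⟨s₁, s₂⟩ := dOne_dTwo_base (f := prodUV) hs.differentiableAt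
    (analyticAt_prodUV p).differentiableAt
  rw [m₁, m₂, m₃, m₄, n₁, n₂, n₃, n₄, x₁, x₂, y₁, y₂, k₁, k₂, s₁, s₂, dOne_coord_one,
    dOne_coord_two, dTwo_coord_one, dTwo_coord_two, dOne_prodUV, dTwo_prodUV]
  have hXY : Complex.exp (β p) * Complex.exp (-β p) = 1 := by rw [← Complex.exp_add]; simp
  generalize Complex.exp (β p) = X at *
  generalize Complex.exp (-β p) = Y at *
  simp only [euler]
  generalize s (prodUV p, p.2) = S
  generalize partialH s (prodUV p, p.2) = S'
  simp only [prodUV]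
  linear_combination (S ^ 2 + 2 * (p.1.1 * p.1.2) * S * S') *
    (1 + (p.1.1 * dOne β p - p.1.2 * dTwo β p)) * hXY

/-- A fibrewise area density is the Jacobian of a map that preserves the foliation by the level
sets of `u₁ u₂`. -/
theorem exists_isochore {J : PhaseSpace → ℂ} (hJ : AnalyticAt ℂ J 0) (hJ0 : J 0 ≠ 0) :
    ∃ (W : PhaseSpace → Plane) (m : Base → ℂ), AnalyticAt ℂ W 0 ∧ W 0 = 0 ∧
      AnalyticAt ℂ m 0 ∧ m 0 ≠ 0 ∧ (∀ᶠ p in 𝓝 (0 : PhaseSpace), jac W p = J p) ∧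
      ∀ᶠ p in 𝓝 (0 : PhaseSpace), prodUV (W p, p.2) = prodUV p * m (prodUV p, p.2) := by
  obtain ⟨a, b, ha, hb, haE, hJab⟩ := exists_average hJ
  obtain ⟨α, hα, haα⟩ := exists_eq_comp_prodUV ha haE
  obtain ⟨m, hm, hmα⟩ := exists_primitive hα
  have h00 : prodUV 0 = 0 := by simp [prodUV]
  have hα0 : α 0 = J 0 := by
    rw [hJab.self_of_nhds, haα.self_of_nhds, fibered_zero h00]
    simp [euler]
  have hm0 : m 0 = J 0 := by
    rw [← hα0, ← hmα.self_of_nhds]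
    simp
  have hm0' : m 0 ≠ 0 := by rwa [hm0]
  obtain ⟨s₀, hs₀⟩ := IsAlgClosed.exists_pow_nat_eq (m 0) (n := 2) (by norm_num)
  have hs₀ne : s₀ ≠ 0 := by rintro rfl; exact hm0' (by rw [← hs₀]; ring)
  obtain ⟨s, hs, -, hsm⟩ := hm.exists_sq_eq hs₀ hs₀ne
  have aα : AnalyticAt ℂ (fun p : PhaseSpace => α (prodUV p, p.2)) 0 :=
    analyticAt_fibered_comp (analyticAt_prodUV 0) h00 hα
  have aα0 : (fun p : PhaseSpace => α (prodUV p, p.2)) 0 ≠ 0 := by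
    simp only [fibered_zero h00, hα0]; exact hJ0
  set β : PhaseSpace → ℂ := fun p => b p / α (prodUV p, p.2) with hβdef
  have hβ : AnalyticAt ℂ β 0 := hb.div aα aα0
  have aS : AnalyticAt ℂ (fun p : PhaseSpace => s (prodUV p, p.2)) 0 :=
    analyticAt_fibered_comp (analyticAt_prodUV 0) h00 hs
  have ht := tendsto_fibered (analyticAt_prodUV 0) h00
  -- E annihilates functions of u₁u₂, so α can be pulled out of E(αβ) = E b.
  have heuler : ∀ᶠ p in 𝓝 (0 : PhaseSpace), J p = α (prodUV p, p.2) * (1 + euler β p) := by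
    have hbβ : ∀ᶠ p in 𝓝 (0 : PhaseSpace), b p = α (prodUV p, p.2) * β p := by
      filter_upwards [aα.continuousAt.eventually_ne aα0] with p hp
      rw [hβdef]
      field_simp
    filter_upwards [hJab, haα, eventually_eventually_nhds.2 hbβ, hβ.eventually_analyticAt,
      ht.eventually hα.eventually_analyticAt, aα.eventually_analyticAt] with p e₁ e₂ e₃ e₄ e₅ e₆
    have hfd : fderiv ℂ b p = fderiv ℂ (fun p => α (prodUV p, p.2) * β p) p :=
      EventuallyEq.fderiv_eq e₃
    have hbE : euler b p = euler (fun p => α (prodUV p, p.2) * β p) p := by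
      simp only [euler, dOne, dTwo, hfd]
    obtain ⟨l₁, l₂⟩ := dOne_dTwo_mul e₆.differentiableAt e₄.differentiableAt
    obtain ⟨k₁, k₂⟩ := dOne_dTwo_base (f := prodUV) e₅.differentiableAt
      (analyticAt_prodUV p).differentiableAt
    rw [e₁, e₂, hbE]
    simp only [euler, l₁, l₂, k₁, k₂, dOne_prodUV, dTwo_prodUV]
    ring
  -- The factors exp(±β) cancel in the product, so u₁u₂ becomes u₁u₂ s² = u₁u₂ m. The scaling
  -- contributes (h m)' = α to the Jacobian and the twist contributes 1 + E β.
  refine ⟨fun p => (p.1.1 * (s (prodUV p, p.2) * Complex.exp (β p)),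
    p.1.2 * (s (prodUV p, p.2) * Complex.exp (-β p))), m,
    ((analyticAt_coord_one 0).mul (aS.mul hβ.cexp')).prod
      ((analyticAt_coord_two 0).mul (aS.mul hβ.neg.cexp')), by simp, hm, hm0', ?_, ?_⟩
  · filter_upwards [heuler, hβ.eventually_analyticAt, ht.eventually hs.eventually_analyticAt,
      ht.eventually (eventually_eventually_nhds.2 hsm), ht.eventually hmα] with p e₁ e₂ e₃ e₄ e₅
    rw [jac_scale_twist e₃ e₂, e₁, ← e₅, ← e₄.self_of_nhds]
    have hc : ContinuousAt (fun t : ℂ => ((t, p.2) : Base)) (prodUV p) := by fun_prop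
    have h1 : (fun t : ℂ => m (t, p.2)) =ᶠ[𝓝 (prodUV p)] fun t => s (t, p.2) ^ 2 :=
      (hc.eventually e₄).mono fun t h => h.symm
    have h2 : DifferentiableAt ℂ (fun t => s (t, p.2)) (prodUV p) :=
      DifferentiableAt.comp (f := fun t : ℂ => ((t, p.2) : Base)) (prodUV p) e₃.differentiableAt
        (by fun_prop)
    have h3 : partialH m (prodUV p, p.2) =
        2 * s (prodUV p, p.2) * partialH s (prodUV p, p.2) := by
      refine h1.deriv_eq.trans ((h2.hasDerivAt.pow 2).deriv.trans ?_)
      simp [partialH]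
    rw [h3]
    ring
  · filter_upwards [ht.eventually hsm] with p e
    have hXY : Complex.exp (β p) * Complex.exp (-β p) = 1 := by rw [← Complex.exp_add]; simp
    rw [← e]
    simp only [prodUV]
    linear_combination p.1.1 * p.1.2 * s (p.1.1 * p.1.2, p.2) ^ 2 * hXY

theorem analyticAt_jac {Φ : PhaseSpace → Plane} (hΦ : AnalyticAt ℂ Φ 0) :
    AnalyticAt ℂ (jac Φ) 0 := by
  have hX : AnalyticAt ℂ (fun p => (Φ p).1) 0 := analyticAt_fst.comp hΦ
  have hY : AnalyticAt ℂ (fun p => (Φ p).2) 0 := analyticAt_snd.comp hΦ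
  refine ((hX.dOne.mul hY.dTwo).sub (hX.dTwo.mul hY.dOne)).congr ?_
  filter_upwards [hΦ.eventually_analyticAt] with p hp
  exact (jac_eq hp.differentiableAt).symm

/-! ### Existence of the Birkhoff-Siegel normalization. -/

/-- Birkhoff-Siegel normalization of a Hamiltonian that is critical along the zero section. -/
theorem exists_isBirkhoffSiegel_of_critical {H : PhaseSpace → ℂ} (hH : AnalyticAt ℂ H 0)
    (hn : (hessian H 0).det ≠ 0)
    (hc : ∀ᶠ p in 𝓝 (0 : PhaseSpace), dOne H (0, p.2) = 0 ∧ dTwo H (0, p.2) = 0) :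
    ∃ Φ G, IsBirkhoffSiegel H Φ G := by
  obtain ⟨φ, hφ, hφ0, hjφ, hHφ⟩ := exists_morse hH hn hc
  obtain ⟨W, m, hW, hW0, hm, hm0, hjW, hWm⟩ := exists_isochore (analyticAt_jac hφ) hjφ
  obtain ⟨V, hV, hV0, hr, -⟩ := exists_fibered_inverse_of_jac hW hW0
    (by rw [hjW.self_of_nhds]; exact hjφ)
  have hA : AnalyticAt ℂ (fun q : Base => q.1 * m q) 0 := analyticAt_fst.mul hm
  -- With V = W⁻¹, the product h satisfies h = A(h∘V) for A(h) = h m(h), so h∘V = B(h) with B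
  -- inverse to A. Thus G = H(0) + B.
  obtain ⟨B, hB, -, -, hl⟩ := hA.exists_fibered_inverse (by simp) fun v hv => by
    have : HasFDerivAt (fun q : Base => q.1 * m q) _ 0 :=
      hasFDerivAt_fst.mul hm.differentiableAt.hasFDerivAt
    rw [this.fderiv] at hv
    simpa [hm0] using hv
  have htV := tendsto_fibered hV hV0
  refine ⟨fun p => φ (V p, p.2), fun q => H (0, q.2) + B q,
    ⟨analyticAt_fibered_comp hV hV0 hφ, by rw [fibered_zero hV0, hφ0], ?_⟩, ?_, ?_⟩
  · filter_upwards [htV.eventually hφ.eventually_analyticAt, hV.eventually_analyticAt,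
      htV.eventually hjW, jac_mul_jac_of_inverse hW hV hV0 hr] with p e₁ e₂ e₃ e₄
    have := jac_comp e₁.differentiableAt e₂.differentiableAt
    rw [← e₃, e₄] at this
    exact this
  · exact (hH.fun_comp_of_eq (f := fun q : Base => (((0 : Plane), q.2) : PhaseSpace))
      (analyticAt_const.prod analyticAt_snd) rfl).add hB
  · have htVh : Tendsto (fun p : PhaseSpace => ((prodUV (V p, p.2), p.2) : Base)) (𝓝 0) (𝓝 0) :=
      (tendsto_fibered (analyticAt_prodUV 0) (by simp [prodUV])).comp htV
    filter_upwards [htV.eventually hHφ, htV.eventually hWm, hr, htVh.eventually hl]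
      with p e₁ e₂ e₃ e₄
    rw [e₁]
    rw [e₃] at e₂
    rw [← e₂] at e₄
    rw [← e₄]
    rfl

theorem jac_translate (y : ℂ × ℂ → Plane) (p : PhaseSpace) :
    jac (fun p : PhaseSpace => y p.2 + p.1) p = 1 := by
  have h : fderiv ℂ (fun u : Plane => y p.2 + u) p.1 = ContinuousLinearMap.id ℂ Plane :=
    ((hasFDerivAt_id p.1).const_add (y p.2)).fderiv
  rw [jac, h, ContinuousLinearMap.det]
  simp

theorem partialOne_translate (F : PhaseSpace → ℂ) (y : ℂ × ℂ → Plane) :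
    partialOne (fun p => F (y p.2 + p.1, p.2)) = fun p => partialOne F (y p.2 + p.1, p.2) := by
  funext p
  exact deriv_comp_const_add (fun t : ℂ => F ((t, (y p.2).2 + p.1.2), p.2)) (y p.2).1 p.1.1

theorem partialTwo_translate (F : PhaseSpace → ℂ) (y : ℂ × ℂ → Plane) :
    partialTwo (fun p => F (y p.2 + p.1, p.2)) = fun p => partialTwo F (y p.2 + p.1, p.2) := by
  funext p
  exact deriv_comp_const_add (fun t : ℂ => F (((y p.2).1 + p.1.1, t), p.2)) (y p.2).2 p.1.2

/-- The critical point of a Hamiltonian depends analytically on the parameters. -/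
theorem IsHamiltonian.exists_critical {H : PhaseSpace → ℂ} (hH : IsHamiltonian H) :
    ∃ y : ℂ × ℂ → Plane, AnalyticAt ℂ y 0 ∧ y 0 = 0 ∧
      ∀ᶠ q in 𝓝 (0 : ℂ × ℂ), partialOne H (y q, q) = 0 ∧ partialTwo H (y q, q) = 0 := by
  have a₁ : AnalyticAt ℂ (partialOne H) 0 :=
    hH.analytic.dOne.congr (eventually_partialOne_eq hH.analytic).symm
  have a₂ : AnalyticAt ℂ (partialTwo H) 0 :=
    hH.analytic.dTwo.congr (eventually_partialTwo_eq hH.analytic).symm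
  have hf : AnalyticAt ℂ (fun p => (partialOne H p, partialTwo H p)) 0 := a₁.prod a₂
  -- The fibrewise Jacobian of the gradient is the Hessian determinant, so the gradient is
  -- invertible on fibres; the critical point is the preimage of 0.
  have hj : jac (fun p => (partialOne H p, partialTwo H p)) 0 ≠ 0 := by
    have := hH.nondegenerate
    simp only [hessian, Matrix.det_fin_two_of, partialOne_eq_dOne a₁.differentiableAt,
      partialOne_eq_dOne a₂.differentiableAt, partialTwo_eq_dTwo a₁.differentiableAt,
      partialTwo_eq_dTwo a₂.differentiableAt] at this
    rw [jac_eq hf.differentiableAt]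
    rwa [mul_comm (dOne (partialTwo H) 0)] at this
  obtain ⟨Ψ, hΨ, hΨ0, hr, -⟩ := exists_fibered_inverse_of_jac hf
    (by rw [hH.critical_one, hH.critical_two]; rfl) hj
  have hi : AnalyticAt ℂ (fun q : ℂ × ℂ => (((0 : Plane), q) : PhaseSpace)) 0 :=
    analyticAt_const.prod analyticAt_id
  have ht : Tendsto (fun q : ℂ × ℂ => (((0 : Plane), q) : PhaseSpace)) (𝓝 0) (𝓝 0) :=
    Continuous.tendsto' (by fun_prop) _ _ rfl
  refine ⟨fun q => Ψ (0, q), hΨ.fun_comp_of_eq hi rfl, hΨ0, ?_⟩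
  filter_upwards [ht.eventually hr] with q hq
  exact ⟨(Prod.ext_iff.1 hq).1, (Prod.ext_iff.1 hq).2⟩

/-- Existence of the Birkhoff-Siegel normalization, with analytic dependence on the parameters. -/
theorem IsHamiltonian.exists_isBirkhoffSiegel {H : PhaseSpace → ℂ} (hH : IsHamiltonian H) :
    ∃ Φ G, IsBirkhoffSiegel H Φ G := by
  obtain ⟨y, hy, hy0, hcrit⟩ := hH.exists_critical
  have hΦ : IsTransverselySymplectic (fun p : PhaseSpace => y p.2 + p.1) :=
    ⟨(hy.fun_comp_of_eq (f := fun p : PhaseSpace => p.2) analyticAt_snd rfl).add analyticAt_fst,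
      by simp [hy0], Eventually.of_forall (jac_translate y)⟩
  have hH' : AnalyticAt ℂ (fun p : PhaseSpace => H (y p.2 + p.1, p.2)) 0 :=
    hΦ.analyticAt_comp hH.analytic
  have hhess : hessian (fun p : PhaseSpace => H (y p.2 + p.1, p.2)) 0 = hessian H 0 := by
    have h0 : ((y (0 : PhaseSpace).2 + (0 : PhaseSpace).1, (0 : PhaseSpace).2) : PhaseSpace) = 0 :=
      fibered_zero (f := fun p : PhaseSpace => y p.2 + p.1) (by simp [hy0])
    simp only [hessian, partialOne_translate, partialTwo_translate, h0]
  obtain ⟨Φ, G, h⟩ := exists_isBirkhoffSiegel_of_critical hH' (by rw [hhess]; exact hH.nondegenerate)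
    (by
      have ht : Tendsto (fun p : PhaseSpace => p.2) (𝓝 0) (𝓝 0) :=
        Continuous.tendsto' (by fun_prop) _ _ rfl
      filter_upwards [tendsto_zero_fiber.eventually hH'.eventually_analyticAt,
        ht.eventually hcrit] with p e₁ e₂
      rw [← partialOne_eq_dOne e₁.differentiableAt, ← partialTwo_eq_dTwo e₁.differentiableAt,
        partialOne_translate, partialTwo_translate]
      simpa using e₂)
  exact ⟨_, G, hΦ.comp h.symplectic, h.analytic, h.normal_form⟩

end ConfluentHamiltonian

theorem corollary2p2 (H : PhaseSpace → ℂ) (hH : IsHamiltonian H) :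
    -- a formal invariant exists, it is unique up to the involution,
    -- and the involution maps formal invariants to formal invariants
    (∃ χ : Base → ℂ, IsFormalInvariant H χ) ∧
    (∀ χ χ' : Base → ℂ, IsFormalInvariant H χ → IsFormalInvariant H χ' →
      χ' =ᶠ[𝓝 0] χ ∨ χ' =ᶠ[𝓝 0] reflection χ) ∧
    (∀ χ : Base → ℂ, IsFormalInvariant H χ → IsFormalInvariant H (reflection χ)) ∧
    -- the involution is induced by the symplectic transformation `u ↦ J u`
    (∀ (Φ : PhaseSpace → Plane) (G χ : Base → ℂ),
      IsBirkhoffSiegel H Φ G → IsRemainder (partialH G) χ →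
        IsBirkhoffSiegel H (Φ ∘ rotJ) (mirror G) ∧
        IsRemainder (partialH (mirror G)) (reflection χ)) ∧
    -- the formal invariant is determined by the polar part of the Hamiltonian
    (∀ K : PhaseSpace → ℂ, IsHamiltonian K → SamePolarPart H K →
      ∀ χ : Base → ℂ, IsFormalInvariant H χ ↔ IsFormalInvariant K χ) ∧
    -- it is invariant under fibered transversely symplectic changes of coordinates
    (∀ (Φ : PhaseSpace → Plane) (K : PhaseSpace → ℂ), IsTransverselySymplectic Φ → IsHamiltonian K →
      Transforms Φ H K →
      ∀ χ : Base → ℂ, IsFormalInvariant H χ ↔ IsFormalInvariant K χ) := by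
  obtain ⟨Φ₀, G₀, h₀⟩ := hH.exists_isBirkhoffSiegel
  have hmirror : ∀ (Φ : PhaseSpace → Plane) (G χ : Base → ℂ),
      IsBirkhoffSiegel H Φ G → IsRemainder (partialH G) χ →
        IsBirkhoffSiegel H (Φ ∘ rotJ) (mirror G) ∧
        IsRemainder (partialH (mirror G)) (reflection χ) := fun Φ G χ h hχ =>
    ⟨h.mirror, by rw [partialH_mirror]; exact hχ.reflection⟩
  refine ⟨?_, ?_, ?_, hmirror, ?_, ?_⟩
  · obtain ⟨χ, hχ⟩ := exists_isRemainder (analyticAt_partialH h₀.analytic)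
    exact ⟨χ, Φ₀, G₀, h₀, hχ⟩
  · rintro χ χ' ⟨Φ, G, h, hχ⟩ ⟨Φ', G', h', hχ'⟩
    rcases (h'.normalizesOn polarLocus).isRemainder hH (h.normalizesOn _) hχ' with e | e
    · exact Or.inl (e.unique hχ (Eventually.of_forall fun _ _ => rfl))
    · exact Or.inr (e.unique (hmirror Φ G χ h hχ).2 (Eventually.of_forall fun _ _ => rfl))
  · rintro χ ⟨Φ, G, h, hχ⟩
    exact ⟨_, _, hmirror Φ G χ h hχ⟩
  · intro K hK hHK χ
    obtain ⟨Φ₁, G₁, h₁⟩ := hK.exists_isBirkhoffSiegel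
    constructor
    · rintro ⟨Φ, G, h, hχ⟩
      exact .of_normalizesOn hH (h.normalizesOn _) (hHK.normalizesOn h₁) h₁ hχ
    · rintro ⟨Φ, G, h, hχ⟩
      exact .of_normalizesOn hK (h.normalizesOn _) (hHK.symm.normalizesOn h₀) h₀ hχ
  · intro Φ K hΦ hK hT χ
    obtain ⟨Φ₁, G₁, h₁⟩ := hK.exists_isBirkhoffSiegel
    constructor
    · rintro ⟨Φ', G, h, hχ⟩
      exact .of_normalizesOn hH (h.normalizesOn _)
        (hT.normalizesOn hH.analytic hK.analytic hΦ h₁) h₁ hχ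
    -- H again serves as the intermediary: the normal form of K is transported to H and compared
    -- there with G₀, so Φ need not be inverted.
    · rintro ⟨Φ', G, h, hχ⟩
      exact .of_normalizesOn hH (hT.normalizesOn hH.analytic hK.analytic hΦ h)
        (h₀.normalizesOn _) h₀ hχ
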